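/- Theorem 1. There is an absolute constant $C_0>0$ such that the following holds. Consider a fully heterogeneous weakly-coupled MDP with $N\ge 1$ arms, finite state space $\mathbb S$, finite action space $\mathbb A$ and $K\ge 1$ cost types: arm $i$ has its own transition kernel $\mathbb P_i(s'\mid s,a)$, reward $r_i(s,a)$ with $|r_i|\le r_{\max}$, and costs $0\le c_{k,i}(s,a)\le c_{\max}$; some action $0$ has $c_{k,i}(s,0)=0$ for all $k,i,s$. The arms move independently given the actions, and the actions must satisfy $\sum_i c_{k,i}(S_{i,t},A_{i,t})\le\alpha_kN$ for all $k$ and $t$, where $\alpha_k>0$; put $\alpha_{\min}=\min_k\alpha_k$. For a policy $\pi$ and an initial state $\boldsymbol S_0$ let $R(\pi,\boldsymbol S_0)=\lim_{T\to\infty}\frac1T\sum_{t<T}\frac1N\sum_i\mathbb E[r_i(S_{i,t},A_{i,t})]$ when the limit exists, let $R^-(\pi,\boldsymbol S_0)$ be the corresponding liminf, and let $R^*(N,\boldsymbol S_0)$ be the supremum of $R^-(\pi,\boldsymbol S_0)$ over all (history-dependent, randomized) policies that satisfy the budget constraints at all times almost surely. Let $y^*$ be any optimal solution of the LP that maximizes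 $\frac1N\sum_{i,s,a}y_i(s,a)r_i(s,a)$ subject to $\frac1N\sum_{i,s,a}y_i(s,a)c_{k,i}(s,a)\le\alpha_k$ for all $k$, $\sum_{s',a'}\mathbb P_i(s\mid s',a')y_i(s',a')=\sum_ay_i(s,a)$ for all $i,s$, $\sum_{s,a}y_i(s,a)=1$ for all $i$, and $y\ge0$. Let $\bar\pi^*_i(a\mid s)=y^*_i(s,a)/\sum_{b}y^*_i(s,b)$ (and $1/|\mathbb A|$ if the denominator is $0$), let $P_i(s,s')=\sum_a\mathbb P_i(s'\mid s,a)\bar\pi_i^*(a\mid s)$ and $\mu_i^*(s)=\sum_ay_i^*(s,a)$. Assume that every $P_i$ is an aperiodic unichain (a single recurrent class, which is aperiodic; transient states are allowed) and that, for some positive integer $\tau$, $\max_s\min\{t\in\mathbb N:\|P_i^t(s,\cdot)-\mu_i^*\|_1\le1/e\}\le\tau$ for all $i$. ID reassignment. Let $C^*_{k,i}=\sum_{s,a}y^*_i(s,a)c_{k,i}(s,a)$, and call $k$ active if $\sum_iC^*_{k,i}\ge\alpha_kN/2$. Let $\delta=\alpha_{\min}/4$ and $d=\lceil(c_{\max}-\delta)K/(\alpha_{\min}/2-\delta)\rceil$.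 If no $k$ is active, the IDs are kept. Otherwise, for $\ell=0,\dots,\lfloor N/d\rfloor-1$ in turn, start with $j=\ell d+1$ and go through the active $k$: whenever the arms that already have a new ID in $\{\ell d+1,\dots,(\ell+1)d\}$ have total $C^*_{k,\cdot}$ less than $\delta$, pick any arm $i$ without new ID and with $C^*_{k,i}\ge\delta$, give it the new ID $j$, and increase $j$ by $1$. Finally the remaining arms get the unused IDs arbitrarily. ID policy with reassignment. At each time sample ideal actions $\widehat A_{i,t}\sim\bar\pi_i^*(\cdot\mid S_{i,t})$, independently over the arms; going through the arms by increasing new ID, let each arm take its ideal action as long as, for every $k$, the total type-$k$ cost of the ideal actions of the arms up to and including it is at most $\alpha_kN$; from the first arm at which this fails on, all arms take action $0$. Then the reassignment algorithm has at least one complete run. Moreover, for each of its possible outcomes and each initial state $\boldsymbol S_0$, the resulting policy $\pi$ satisfies the budget constraints, $R(\pi,\boldsymbol S_0)$ exists, and $$R^*(N,\boldsymbol S_0)-R(\pi,\boldsymbol S_0)\le\frac{C_{\mathrm{ID}}}{\sqrt N},\qquad C_{\mathrm{ID}}=C_0\,\frac{K^5\max\{r_{\max},c_{\max}\}^7\,\tau^4}{\alpha_{\min}^6},$$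 so $C_{\mathrm{ID}}$ does not depend on $N$. -/

import Mathlib

open Filter Topology
open scoped ENNReal

noncomputable section

/-- The joint law of independent random variables with laws `p i`. -/
def prodPMF {ι β : Type*} [Fintype ι] [DecidableEq ι] [Fintype β] (p : ι → PMF β) :
    PMF (ι → β) :=
  PMF.ofFintype (fun f => ∏ i, p i (f i)) (by
    have h : ∀ i, ∑ b, p i b = 1 := fun i => by rw [← tsum_fintype (L := .unconditional _)]; exact (p i).tsum_coe
    have h2 := Finset.prod_univ_sum (fun _ : ι => (Finset.univ : Finset β)) (fun i b => p i b)
    rw [Fintype.piFinset_univ] at h2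
    rw [← h2]
    exact Finset.prod_eq_one fun i _ => h i)

/-! ### Finite Markov chains given by a transition matrix -/

section MarkovChain

variable {S : Type*} [Fintype S] [DecidableEq S]

/-- State `s'` can be reached from state `s`. -/
def Reaches (P : Matrix S S ℝ) (s s' : S) : Prop := ∃ n : ℕ, 0 < (P ^ n) s s'

/-- Recurrent states of a finite chain: every state reachable from `s` leads back to `s`. -/
def IsRecurrent (P : Matrix S S ℝ) (s : S) : Prop := ∀ s', Reaches P s s' → Reaches P s' s

/-- Aperiodic unichain: all recurrent states form a single communicating class, and the
period (the gcd of the return times) of each recurrent state is `1`. Transient states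
are allowed. -/
def IsAperiodicUnichain (P : Matrix S S ℝ) : Prop :=
  (∀ s s', IsRecurrent P s → IsRecurrent P s' → Reaches P s s') ∧
  (∀ s, IsRecurrent P s →
    ∀ d : ℕ, (∀ n : ℕ, 0 < n → 0 < (P ^ n) s s → d ∣ n) → d = 1)

/-- The mixing time `max_s min {t : ‖P^t(s, ·) - μ‖₁ ≤ 1/e}`, with `min ∅ = ∞`. -/
def mixingTime (P : Matrix S S ℝ) (μ : S → ℝ) : ℕ∞ :=
  ⨆ s, ⨅ t ∈ {t : ℕ | ∑ s', |(P ^ t) s s' - μ s'| ≤ 1 / Real.exp 1}, (t : ℕ∞)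

end MarkovChain

/-! ### Weakly coupled Markov decision processes -/

/-- A fully heterogeneous `N`-armed weakly coupled MDP with `K` budget constraints: each arm
`i` has its own transition kernel, reward function and cost functions. The budget for cost
type `k` is `budget k * N`. -/
structure WCMDP (S A : Type*) (K N : ℕ) where
  /-- `trans i s a` is the law of the next state of arm `i`. -/
  trans : Fin N → S → A → PMF S
  reward : Fin N → S → A → ℝ
  cost : Fin K → Fin N → S → A → ℝ
  budget : Fin K → ℝ
  /-- the action that never incurs any cost -/
  zeroAction : A
  cost_nonneg : ∀ k i s a, 0 ≤ cost k i s a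
  cost_zeroAction : ∀ k i s, cost k i s zeroAction = 0
  budget_pos : ∀ k, 0 < budget k

/-- A history-dependent randomized policy for the `N`-armed system: it maps the list of past
(system state, system action) pairs, most recent first, and the current system state to a law
on system actions. -/
def Policy (S A : Type*) (N : ℕ) : Type _ :=
  List ((Fin N → S) × (Fin N → A)) → (Fin N → S) → PMF (Fin N → A)

namespace WCMDP

variable {S A : Type*} [Fintype S] [Fintype A] {K N : ℕ}

/-! #### Dynamics, average reward, optimal value -/

/-- Given the system state and action, the arms make independent transitions. -/
def sysTrans (W : WCMDP S A K N) (s : Fin N → S) (a : Fin N → A) : PMF (Fin N → S) :=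
  prodPMF fun i => W.trans i (s i) (a i)

/-- Joint law of the history before time `t` and the system state at time `t`. -/
def historyLaw (W : WCMDP S A K N) (π : Policy S A N) (s₀ : Fin N → S) :
    ℕ → PMF (List ((Fin N → S) × (Fin N → A)) × (Fin N → S))
  | 0 => PMF.pure ([], s₀)
  | t + 1 => (historyLaw W π s₀ t).bind fun hs =>
      (π hs.1 hs.2).bind fun a =>
        (W.sysTrans hs.2 a).map fun s' => ((hs.2, a) :: hs.1, s')

/-- Joint law of the system state and the system action at time `t`. -/
def stateActionLaw (W : WCMDP S A K N) (π : Policy S A N) (s₀ : Fin N → S) (t : ℕ) :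
    PMF ((Fin N → S) × (Fin N → A)) :=
  (W.historyLaw π s₀ t).bind fun hs => (π hs.1 hs.2).map fun a => (hs.2, a)

/-- Expected total reward of all arms at time `t`. -/
def expectedReward (W : WCMDP S A K N) (π : Policy S A N) (s₀ : Fin N → S) (t : ℕ) : ℝ :=
  ∑ p : (Fin N → S) × (Fin N → A),
    (W.stateActionLaw π s₀ t p).toReal * ∑ i, W.reward i (p.1 i) (p.2 i)

/-- Expected time-average reward per arm over the first `T` steps. -/
def avgReward (W : WCMDP S A K N) (π : Policy S A N) (s₀ : Fin N → S) (T : ℕ) : ℝ :=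
  (1 / (T : ℝ)) * ∑ t ∈ Finset.range T, (1 / (N : ℝ)) * W.expectedReward π s₀ t

/-- The liminf average reward `R⁻(π, s₀)`. -/
def liminfReward (W : WCMDP S A K N) (π : Policy S A N) (s₀ : Fin N → S) : ℝ :=
  liminf (fun T => W.avgReward π s₀ T) atTop

/-- The budget constraints hold at all times, almost surely. -/
def IsFeasible (W : WCMDP S A K N) (π : Policy S A N) (s₀ : Fin N → S) : Prop :=
  ∀ t, ∀ p ∈ (W.stateActionLaw π s₀ t).support, ∀ k,
    ∑ i, W.cost k i (p.1 i) (p.2 i) ≤ W.budget k * N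

/-- The optimal value `R*(N, s₀)`. -/
def optimalValue (W : WCMDP S A K N) (s₀ : Fin N → S) : ℝ :=
  sSup {x | ∃ π : Policy S A N, W.IsFeasible π s₀ ∧ x = W.liminfReward π s₀}

/-! #### The linear-programming relaxation -/

/-- Feasible points of the LP relaxation. -/
structure IsLPFeasible (W : WCMDP S A K N) (y : Fin N → S → A → ℝ) : Prop where
  nonneg : ∀ i s a, 0 ≤ y i s a
  sum_eq_one : ∀ i, ∑ s, ∑ a, y i s a = 1
  stationary : ∀ i s, ∑ s', ∑ a', (W.trans i s' a' s).toReal * y i s' a' = ∑ a, y i s a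
  budget_le : ∀ k, (1 / (N : ℝ)) * ∑ i, ∑ s, ∑ a, y i s a * W.cost k i s a ≤ W.budget k

/-- The LP objective. -/
def lpValue (W : WCMDP S A K N) (y : Fin N → S → A → ℝ) : ℝ :=
  (1 / (N : ℝ)) * ∑ i, ∑ s, ∑ a, y i s a * W.reward i s a

/-- Optimal solutions of the LP relaxation. -/
def IsLPOptimal (W : WCMDP S A K N) (y : Fin N → S → A → ℝ) : Prop :=
  W.IsLPFeasible y ∧ ∀ y', W.IsLPFeasible y' → W.lpValue y' ≤ W.lpValue y

/-! #### Optimal single-armed policies -/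

/-- Probability that the single-armed policy of arm `i` takes action `a` in state `s`. -/
def singleArmProb (y : Fin N → S → A → ℝ) (i : Fin N) (s : S) (a : A) : ℝ :=
  if 0 < ∑ b, y i s b then y i s a / ∑ b, y i s b else 1 / (Fintype.card A : ℝ)

theorem singleArmProb_nonneg (y : Fin N → S → A → ℝ) (hy : ∀ i s a, 0 ≤ y i s a)
    (i : Fin N) (s : S) (a : A) : 0 ≤ singleArmProb y i s a := by
  unfold singleArmProb
  split_ifs with h
  · exact div_nonneg (hy i s a) h.le
  · positivity

theorem sum_singleArmProb [Nonempty A] (y : Fin N → S → A → ℝ) (i : Fin N) (s : S) :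
    ∑ a, singleArmProb y i s a = 1 := by
  unfold singleArmProb
  split_ifs with h
  · rw [← Finset.sum_div, div_self h.ne']
  · simp

/-- The single-armed policy of arm `i` as a law on actions. -/
def singleArmPolicy (W : WCMDP S A K N) (y : Fin N → S → A → ℝ) (hy : ∀ i s a, 0 ≤ y i s a)
    (i : Fin N) (s : S) : PMF A :=
  PMF.ofFintype (fun a => ENNReal.ofReal (singleArmProb y i s a)) (by
    have : Nonempty A := ⟨W.zeroAction⟩
    rw [← ENNReal.ofReal_sum_of_nonneg fun a _ => singleArmProb_nonneg y hy i s a,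
      sum_singleArmProb y i s, ENNReal.ofReal_one])

/-- Transition matrix of arm `i` under its single-armed policy. -/
def singleArmMatrix (W : WCMDP S A K N) (y : Fin N → S → A → ℝ) (i : Fin N) : Matrix S S ℝ :=
  Matrix.of fun s s' => ∑ a, (W.trans i s a s').toReal * singleArmProb y i s a

/-- The optimal state distribution of arm `i`. -/
def stateDist (y : Fin N → S → A → ℝ) (i : Fin N) (s : S) : ℝ := ∑ a, y i s a

/-! #### ID reassignment -/

/-- Expected type-`k` cost of arm `i` under its single-armed policy. -/
def meanCost (W : WCMDP S A K N) (y : Fin N → S → A → ℝ) (k : Fin K) (i : Fin N) : ℝ :=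
  ∑ s, ∑ a, y i s a * W.cost k i s a

/-- The type-`k` budget constraint is active. -/
def IsActive (W : WCMDP S A K N) (y : Fin N → S → A → ℝ) (k : Fin K) : Prop :=
  W.budget k / 2 * N ≤ ∑ i, W.meanCost y k i

/-- `α_min = min_k α_k` (used for `K ≥ 1`). -/
def minBudget (W : WCMDP S A K N) : ℝ := ⨅ k, W.budget k

/-- The cost threshold `δ = α_min / 4`. -/
def threshold (W : WCMDP S A K N) : ℝ := W.minBudget / 4

/-- The group size `d = ⌈(c_max - δ) K / (α_min / 2 - δ)⌉`. -/
def groupSize (W : WCMDP S A K N) (cmax : ℝ) : ℕ :=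
  ⌈(cmax - W.threshold) * K / (W.minBudget / 2 - W.threshold)⌉₊

/-- `RunList step l x x'`: executing the nondeterministic steps `step b` for the entries `b` of
`l`, in this order, can lead from memory state `x` to memory state `x'`. -/
def RunList {β X : Type*} (step : β → X → X → Prop) : List β → X → X → Prop
  | [], x, x' => x' = x
  | b :: l, x, x' => ∃ z, step b x z ∧ RunList step l z x'

/-- Total mean type-`k` cost of the arms that a partial assignment `σ` of new IDs has placed in
group `ℓ`. New IDs are counted from `0`, so the group is `{ℓ d, …, (ℓ + 1) d - 1}`. -/
def groupCost (W : WCMDP S A K N) (cmax : ℝ) (y : Fin N → S → A → ℝ) (ℓ : ℕ) (k : Fin K)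
    (σ : Fin N → Option ℕ) : ℝ :=
  open Classical in
  ∑ i, if ∃ p, σ i = some p ∧ ℓ * W.groupSize cmax ≤ p ∧ p < (ℓ + 1) * W.groupSize cmax
    then W.meanCost y k i else 0

/-- Body of the inner loop of the reassignment, for group `ℓ` and constraint `k`; the memory
is the partial assignment together with the next free ID `j`. If the group does not have enough
type-`k` cost yet, then any not yet assigned arm with mean type-`k` cost at least `δ` is picked
and gets the ID `j`. -/
def AssignStep (W : WCMDP S A K N) (cmax : ℝ) (y : Fin N → S → A → ℝ) (ℓ : ℕ) (k : Fin K)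
    (x x' : (Fin N → Option ℕ) × ℕ) : Prop :=
  (W.groupCost cmax y ℓ k x.1 < W.threshold →
    ∃ i, W.threshold ≤ W.meanCost y k i ∧ x.1 i = none ∧
      x' = (Function.update x.1 i (some x.2), x.2 + 1)) ∧
  (W.threshold ≤ W.groupCost cmax y ℓ k x.1 → x' = x)

/-- Body of the outer loop, for group `ℓ`: the active constraints are treated one after the
other, in any order. -/
def GroupStep (W : WCMDP S A K N) (cmax : ℝ) (y : Fin N → S → A → ℝ) (ℓ : ℕ)
    (σ σ' : Fin N → Option ℕ) : Prop :=
  ∃ l : List (Fin K), l.Nodup ∧ (∀ k, k ∈ l ↔ W.IsActive y k) ∧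
    ∃ j', RunList (W.AssignStep cmax y ℓ) l (σ, ℓ * W.groupSize cmax) (σ', j')

/-- `e` (old ID ↦ new ID, counted from `0`) is a possible output of the ID reassignment
algorithm. Without active constraints the IDs are kept; otherwise the groups are processed in
turn and the arms without new ID get the unused IDs arbitrarily. -/
def IsReassignment (W : WCMDP S A K N) (cmax : ℝ) (y : Fin N → S → A → ℝ)
    (e : Equiv.Perm (Fin N)) : Prop :=
  ((∀ k, ¬ W.IsActive y k) → e = Equiv.refl (Fin N)) ∧
  ((∃ k, W.IsActive y k) → ∃ σ : Fin N → Option ℕ,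
    RunList (W.GroupStep cmax y) (List.range (N / W.groupSize cmax)) (fun _ => none) σ ∧
    ∀ i p, σ i = some p → (e i : ℕ) = p)

/-! #### The ID policy -/

/-- The actions executed by the ID policy in system state `s` when the sampled ideal actions are
`ah` and the new IDs are given by `e`. Arms are processed by increasing new ID; arm `i`
executes its ideal action as long as for each ID `m` up to its own the ideal actions of the
arms with ID at most `m` respect all budgets; all remaining arms take the zero action. -/
def executed (W : WCMDP S A K N) (e : Equiv.Perm (Fin N)) (s : Fin N → S) (ah : Fin N → A) :
    Fin N → A :=
  open Classical in
  fun i =>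
    if ∀ m ≤ e i, ∀ k, ∑ j with e j ≤ m, W.cost k j (s j) (ah j) ≤ W.budget k * N
    then ah i else W.zeroAction

/-- The ID policy: sample independent ideal actions from the single-armed policies, then
execute them by priority of the new IDs. -/
def idPolicy (W : WCMDP S A K N) (y : Fin N → S → A → ℝ) (hy : ∀ i s a, 0 ≤ y i s a)
    (e : Equiv.Perm (Fin N)) : Policy S A N :=
  fun _ s => (prodPMF fun i => W.singleArmPolicy y hy i (s i)).map (W.executed e s)

end WCMDP

end

/-! The LP value bounds every feasible policy from above: time-averaged state-action occupancies lie
in a compact cube and violate stationarity by at most `1/T`, so limit points are LP-feasible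
(`liminfReward_le_lpValue`). It remains to show that the ID policy loses only `O(1/√N)` against the
LP value. Its state process is a finite Markov chain, so its average reward converges by the mean
ergodic theorem (`exists_tendsto_cesaro_expect`).

Each state of each arm gets a feature vector in `ℓ²`, listing the predicted deviations from
stationarity of its reward and costs at all future times under the single-armed policy, with
geometric weights. One ideal step acts on these vectors, in expectation, as `γ` times a left shift,
with `γ = 1 - 1/(4τ)`, and mixing keeps their norms below some `B` of order `√(Kτ) M`, where `M =
max rmax cmax` (`exists_feature`). Thus one Hilbert norm is contracted by the ideal dynamics and
controls current rewards and costs.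

The reassignment spreads costly arms over the ID range, so the first `n` IDs leave a mean budget
slack of at least `2β(N - n) - c` (`sum_meanCost_prefix_le`). Call a prefix good if the norm of its
feature sum is at most `β(N - n)`. On good prefixes half of the slack absorbs the state deviation
and the other half the sampling noise, which a maximal inequality (`exists_maximal_bound`) bounds by
`O(√N)` for all prefixes at once. Hence all arms outside a tail execute their ideal actions, the
tail being governed by the larger of the `deficit` and a random `O(√N)` term
(`exists_fluctuation_bound`).

Prefixes of arms acting ideally contract up to noise, and contraction creates room to enlarge the
range of good prefixes (`deficit_step_le`). So the expected deficit obeys `E u' ≤ (1 - ρ) u + O(√N)`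
(`expect_deficit_le`), and its long-run average is `O(√N)`. The reward lost per step is linear in
the deficit up to `O(√N)` (`le_expect_reward`); division by `N` gives the rate. If `cmax` is at most
the smallest budget, no constraint can bind and the LP value is attained
(`lpValue_le_of_not_binding`). -/

open Filter Topology
open scoped ENNReal

noncomputable section

/-! ### Expectations on finite probability spaces -/

section Expectation

variable {α β V : Type*} [Fintype α] [Fintype β] [AddCommGroup V] [Module ℝ V]

/-- Expectation of a vector-valued function on a finite probability space. -/
def PMF.expect (p : PMF α) (f : α → V) : V := ∑ a, (p a).toReal • f a

namespace PMF

theorem sum_toReal (p : PMF α) : ∑ a, (p a).toReal = 1 := by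
  rw [← ENNReal.toReal_sum fun a _ => p.apply_ne_top a,
    ← tsum_fintype (L := .unconditional _), p.tsum_coe, ENNReal.toReal_one]

theorem expect_const (p : PMF α) (c : V) : p.expect (fun _ => c) = c := by
  rw [expect, ← Finset.sum_smul, p.sum_toReal, one_smul]

theorem expect_add (p : PMF α) (f g : α → V) :
    p.expect (fun a => f a + g a) = p.expect f + p.expect g := by
  simp [expect, smul_add, Finset.sum_add_distrib]

theorem expect_sub (p : PMF α) (f g : α → V) :
    p.expect (fun a => f a - g a) = p.expect f - p.expect g := by
  simp [expect, smul_sub, Finset.sum_sub_distrib]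

theorem expect_smul (p : PMF α) (c : ℝ) (f : α → V) :
    p.expect (fun a => c • f a) = c • p.expect f := by
  simp only [expect, Finset.smul_sum]
  exact Finset.sum_congr rfl fun a _ => smul_comm _ _ _

theorem expect_const_mul (p : PMF α) (c : ℝ) (f : α → ℝ) :
    p.expect (fun a => c * f a) = c * p.expect f := p.expect_smul c f

theorem expect_sum {ι : Type*} (p : PMF α) (s : Finset ι) (f : ι → α → V) :
    p.expect (fun a => ∑ i ∈ s, f i a) = ∑ i ∈ s, p.expect (f i) := by
  simp only [expect, Finset.smul_sum]
  exact Finset.sum_comm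

theorem expect_mono (p : PMF α) {f g : α → ℝ} (h : ∀ a, f a ≤ g a) :
    p.expect f ≤ p.expect g :=
  Finset.sum_le_sum fun a _ => mul_le_mul_of_nonneg_left (h a) ENNReal.toReal_nonneg

theorem expect_nonneg (p : PMF α) {f : α → ℝ} (h : ∀ a, 0 ≤ f a) : 0 ≤ p.expect f :=
  Finset.sum_nonneg fun a _ => mul_nonneg ENNReal.toReal_nonneg (h a)

theorem expect_le_of_le (p : PMF α) {f : α → ℝ} {c : ℝ} (h : ∀ a, f a ≤ c) :
    p.expect f ≤ c := (p.expect_mono h).trans_eq (p.expect_const c)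

theorem norm_expect_le {E : Type*} [NormedAddCommGroup E] [NormedSpace ℝ E] (p : PMF α)
    (f : α → E) : ‖p.expect f‖ ≤ p.expect fun a => ‖f a‖ := by
  refine (norm_sum_le _ _).trans_eq (Finset.sum_congr rfl fun a _ => ?_)
  rw [norm_smul, Real.norm_of_nonneg ENNReal.toReal_nonneg, smul_eq_mul]

theorem norm_expect_le_of_le {E : Type*} [NormedAddCommGroup E] [NormedSpace ℝ E] (p : PMF α)
    {f : α → E} {c : ℝ} (h : ∀ a, ‖f a‖ ≤ c) : ‖p.expect f‖ ≤ c :=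
  (p.norm_expect_le f).trans (p.expect_le_of_le h)

theorem map_expect {V' : Type*} [AddCommGroup V'] [Module ℝ V'] (p : PMF α) (T : V →ₗ[ℝ] V')
    (f : α → V) : T (p.expect f) = p.expect fun a => T (f a) := by
  simp [expect, map_sum]

theorem expect_pure [DecidableEq α] (a : α) (f : α → V) : (PMF.pure a).expect f = f a := by
  rw [expect, Finset.sum_eq_single a]
  · simp
  · intro b _ hb
    simp [PMF.pure_apply, hb]
  · simp

theorem toReal_bind_apply {γ : Type*} (p : PMF α) (q : α → PMF γ) (c : γ) :
    (p.bind q c).toReal = ∑ a, (p a).toReal * (q a c).toReal := by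
  rw [PMF.bind_apply, tsum_fintype, ENNReal.toReal_sum]
  · simp [ENNReal.toReal_mul]
  · exact fun a _ => ENNReal.mul_ne_top (p.apply_ne_top a) ((q a).apply_ne_top c)

theorem expect_bind (p : PMF α) (q : α → PMF β) (f : β → V) :
    (p.bind q).expect f = p.expect fun a => (q a).expect f := by
  simp only [expect, toReal_bind_apply, Finset.sum_smul, Finset.smul_sum, mul_smul]
  exact Finset.sum_comm

theorem expect_map (p : PMF α) (g : α → β) (f : β → V) :
    (p.map g).expect f = p.expect fun a => f (g a) := by
  classical
  change (p.bind (PMF.pure ∘ g)).expect f = _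
  rw [expect_bind]
  simp [expect_pure]

end PMF

end Expectation

/-! ### Independent random variables -/

section Independence

variable {ι β : Type*} [Fintype ι] [DecidableEq ι] [Fintype β]

theorem prodPMF_toReal (p : ι → PMF β) (f : ι → β) :
    (prodPMF p f).toReal = ∏ i, (p i (f i)).toReal := by
  simp [prodPMF, ENNReal.toReal_prod]

/-- Resampling one coordinate does not change the expectation. -/
theorem prodPMF_expect_update {V : Type*} [AddCommGroup V] [Module ℝ V] (p : ι → PMF β) (i : ι)
    (g : (ι → β) → V) :
    (prodPMF p).expect g =
      (prodPMF p).expect fun f => (p i).expect fun b => g (Function.update f i b) := by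
  -- Separating coordinate `i` from the others makes the resampling visible: the old value of `i` no
  -- longer enters the integrand, and its weights sum to one.
  have key : ∀ G : (ι → β) → V, (prodPMF p).expect G =
      ∑ b : β, ∑ h : {j // j ≠ i} → β, ((p i b).toReal * ∏ j : {j // j ≠ i}, (p j (h j)).toReal) •
        G ((Equiv.funSplitAt i β).symm (b, h)) := by
    intro G
    rw [PMF.expect, ← (Equiv.funSplitAt i β).symm.sum_comp, Fintype.sum_prod_type]
    refine Finset.sum_congr rfl fun b _ => Finset.sum_congr rfl fun h _ => ?_
    congr 1
    rw [prodPMF_toReal, Fintype.prod_eq_mul_prod_subtype_ne _ i]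
    congr 1
    · simp [Equiv.funSplitAt]
    · refine Finset.prod_congr rfl fun j _ => ?_
      simp [Equiv.funSplitAt, j.2]
  rw [key, key]
  have hup : ∀ b h b', Function.update ((Equiv.funSplitAt i β).symm (b, h)) i b' =
      (Equiv.funSplitAt i β).symm (b', h) := by
    intro b h b'
    ext j
    by_cases hj : j = i
    · subst hj; simp [Equiv.funSplitAt]
    · simp [Equiv.funSplitAt, hj]
  simp only [hup]
  rw [Finset.sum_comm]
  conv_rhs => rw [Finset.sum_comm]
  refine Finset.sum_congr rfl fun h _ => ?_
  conv_rhs => rw [← Finset.sum_smul, ← Finset.sum_mul, PMF.sum_toReal, one_mul, PMF.expect,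
    Finset.smul_sum]
  refine Finset.sum_congr rfl fun b _ => ?_
  rw [smul_smul, mul_comm]

theorem prodPMF_expect_eval {V : Type*} [AddCommGroup V] [Module ℝ V] (p : ι → PMF β) (i : ι)
    (g : β → V) : (prodPMF p).expect (fun f => g (f i)) = (p i).expect g := by
  rw [prodPMF_expect_update p i]
  simp [PMF.expect_const]

variable {E : Type*} [NormedAddCommGroup E] [InnerProductSpace ℝ E]

/-- A centered coordinate is uncorrelated with every function of the other coordinates. -/
theorem prodPMF_expect_inner_eq_zero (p : ι → PMF β) (i : ι) (F : (ι → β) → E) (ξ : β → E)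
    (hF : ∀ f b, F (Function.update f i b) = F f) (hξ : (p i).expect ξ = 0) :
    (prodPMF p).expect (fun f => inner ℝ (F f) (ξ (f i))) = 0 := by
  rw [prodPMF_expect_update p i]
  simp only [hF, Function.update_self]
  have : ∀ f, ((p i).expect fun b => inner ℝ (F f) (ξ b)) = 0 := by
    intro f
    have := (p i).map_expect (innerₛₗ ℝ (F f)) ξ
    simpa [hξ] using this.symm
  simp [this, PMF.expect_const]

/-- `L¹` maximal inequality for partial sums of independent centered bounded random vectors. -/
theorem exists_maximal_bound {N : ℕ} (e : Equiv.Perm (Fin N)) (p : Fin N → PMF β)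
    (ξ : Fin N → β → E) {b : ℝ} (hb : 0 ≤ b) (hcent : ∀ i, (p i).expect (ξ i) = 0)
    (hbd : ∀ i x, ‖ξ i x‖ ≤ b) :
    ∃ D : (Fin N → β) → ℝ, (∀ f, 0 ≤ D f) ∧
      (∀ f, ∀ n ≤ N, ‖∑ i with (e i : ℕ) < n, ξ i (f i)‖ ≤ D f) ∧
      (prodPMF p).expect D ≤ 2 * b * √N := by
  rcases Nat.eq_zero_or_pos N with hN | hN
  · subst hN
    exact ⟨fun _ => 0, fun _ => le_rfl, fun f n _ => by simp, by simp [PMF.expect_const]⟩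
  rcases hb.eq_or_lt with hb0 | hb0
  · refine ⟨fun _ => 0, fun _ => le_rfl, fun f n _ => ?_, by simp [PMF.expect_const, ← hb0]⟩
    have : ∀ i x, ξ i x = 0 := fun i x => by
      simpa [← hb0] using hbd i x
    simp [this]
  set S : ℕ → (Fin N → β) → E := fun n f => ∑ i with (e i : ℕ) < n, ξ i (f i) with hS
  have hsN : 0 < √(N : ℝ) := by positivity
  set M₀ : ℝ := b * √N with hM₀
  have hM₀pos : 0 < M₀ := by positivity
  have hdep : ∀ n (i : Fin N), n ≤ (e i : ℕ) → ∀ f x, S n (Function.update f i x) = S n f := by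
    intro n i hi f x
    refine Finset.sum_congr rfl fun j hj => ?_
    have : j ≠ i := by
      rintro rfl
      exact absurd (Finset.mem_filter.1 hj).2 (by omega)
    rw [Function.update_of_ne this]
  -- The potential `D + ‖S‖² / D`, with `D` the running maximum started at `M₀`, grows in
  -- expectation by at most `b² / M₀` per step. Since `D` and `S n` do not depend on later
  -- coordinates, the cross term of the next step is centered.
  have main : ∀ n ≤ N, ∃ D : (Fin N → β) → ℝ, (∀ f, M₀ ≤ D f) ∧
      (∀ f, ∀ j ≤ n, ‖S j f‖ ≤ D f) ∧
      (∀ i : Fin N, n ≤ (e i : ℕ) → ∀ f x, D (Function.update f i x) = D f) ∧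
      (prodPMF p).expect (fun f => D f + ‖S n f‖ ^ 2 / D f) ≤ M₀ + n * (b ^ 2 / M₀) := by
    intro n
    induction n with
    | zero =>
      intro _
      refine ⟨fun _ => M₀, fun _ => le_rfl, fun f j hj => ?_, fun _ _ _ _ => rfl, ?_⟩
      · obtain rfl : j = 0 := by omega
        simp [hS, hM₀pos.le]
      · simp [hS, PMF.expect_const]
    | succ n ih =>
      intro hn
      obtain ⟨D, hD0, hDle, hDdep, hDE⟩ := ih (by omega)
      set i₀ : Fin N := e.symm ⟨n, by omega⟩ with hi₀
      have hei₀ : (e i₀ : ℕ) = n := by simp [hi₀]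
      have hstep : ∀ f, S (n + 1) f = S n f + ξ i₀ (f i₀) := by
        intro f
        have : (Finset.univ.filter fun i : Fin N => (e i : ℕ) < n + 1) =
            insert i₀ (Finset.univ.filter fun i : Fin N => (e i : ℕ) < n) := by
          ext i
          simp only [Finset.mem_filter, Finset.mem_univ, true_and, Finset.mem_insert]
          constructor
          · intro h
            rcases Nat.lt_succ_iff_lt_or_eq.1 h with h | h
            · exact Or.inr h
            · exact Or.inl (e.injective (Fin.ext (h.trans hei₀.symm)))
          · rintro (rfl | h) <;> omega
        simp only [hS]
        rw [this, Finset.sum_insert (by simp [hei₀]), add_comm]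
      refine ⟨fun f => max (D f) ‖S (n + 1) f‖, fun f => (hD0 f).trans (le_max_left _ _),
        fun f j hj => ?_, fun i hi f x => ?_, ?_⟩
      · rcases Nat.le_succ_iff.1 hj with h | h
        · exact (hDle f j h).trans (le_max_left _ _)
        · subst h; exact le_max_right _ _
      · simp only [hDdep i (by omega), hdep (n + 1) i hi]
      · have hpt : ∀ f, max (D f) ‖S (n + 1) f‖ + ‖S (n + 1) f‖ ^ 2 / max (D f) ‖S (n + 1) f‖ ≤
            (D f + ‖S n f‖ ^ 2 / D f) +
              (2 * inner ℝ ((D f)⁻¹ • S n f) (ξ i₀ (f i₀)) + b ^ 2 / M₀) := by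
          intro f
          have hDf : 0 < D f := hM₀pos.trans_le (hD0 f)
          have h1 : max (D f) ‖S (n + 1) f‖ + ‖S (n + 1) f‖ ^ 2 / max (D f) ‖S (n + 1) f‖ ≤
              D f + ‖S (n + 1) f‖ ^ 2 / D f := by
            rcases le_total ‖S (n + 1) f‖ (D f) with h | h
            · rw [max_eq_left h]
            · rw [max_eq_right h]
              have hs : 0 < ‖S (n + 1) f‖ := hDf.trans_le h
              rw [sq, mul_div_assoc, div_self hs.ne', mul_one, ← sub_nonneg]
              -- When a new maximum `s` is reached the potential becomes `2s`, and `2s ≤ D + s² / D`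
              -- by completing the square.
              have : D f + ‖S (n + 1) f‖ * ‖S (n + 1) f‖ / D f -
                  (‖S (n + 1) f‖ + ‖S (n + 1) f‖) = (‖S (n + 1) f‖ - D f) ^ 2 / D f := by
                field_simp
                ring
              rw [this]
              positivity
          have h2 : ‖S (n + 1) f‖ ^ 2 = ‖S n f‖ ^ 2 + 2 * inner ℝ (S n f) (ξ i₀ (f i₀)) +
              ‖ξ i₀ (f i₀)‖ ^ 2 := by
            rw [hstep, norm_add_sq_real]
          have h3 : ‖ξ i₀ (f i₀)‖ ^ 2 / D f ≤ b ^ 2 / M₀ := by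
            have := hbd i₀ (f i₀)
            have := hD0 f
            gcongr
          refine h1.trans ?_
          rw [h2, add_div, add_div, real_inner_smul_left]
          have : 2 * inner ℝ (S n f) (ξ i₀ (f i₀)) / D f =
            2 * ((D f)⁻¹ * inner ℝ (S n f) (ξ i₀ (f i₀))) := by
            field_simp
          linarith
        have hz := prodPMF_expect_inner_eq_zero p i₀ (fun f => (D f)⁻¹ • S n f) (ξ i₀)
          (fun f x => by simp only [hDdep i₀ hei₀.ge, hdep n i₀ hei₀.ge]) (hcent i₀)
        refine ((prodPMF p).expect_mono hpt).trans ?_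
        rw [PMF.expect_add, PMF.expect_add _ (fun f => 2 * _), PMF.expect_const_mul, hz,
          PMF.expect_const]
        push_cast
        linarith
  obtain ⟨D, hD0, hDle, -, hDE⟩ := main N le_rfl
  refine ⟨D, fun f => hM₀pos.le.trans (hD0 f), hDle, ?_⟩
  refine ((prodPMF p).expect_mono fun f => ?_).trans (hDE.trans_eq ?_)
  · have : 0 < D f := hM₀pos.trans_le (hD0 f)
    have : 0 ≤ ‖S N f‖ ^ 2 / D f := by positivity
    linarith
  · rw [hM₀]
    have hsq : √(N : ℝ) * √N = N := Real.mul_self_sqrt (by positivity)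
    field_simp
    nlinarith [hsq]

end Independence

/-! ### Geometric mixing of finite Markov chains -/

section Mixing

variable {S : Type*} [Fintype S]

/-- Nonnegative matrices with unit row sums. -/
structure IsStochastic (P : Matrix S S ℝ) : Prop where
  nonneg : ∀ s s', 0 ≤ P s s'
  sum_row : ∀ s, ∑ s', P s s' = 1

theorem IsStochastic.mul {P Q : Matrix S S ℝ} (hP : IsStochastic P) (hQ : IsStochastic Q) :
    IsStochastic (P * Q) where
  nonneg s s' := Finset.sum_nonneg fun _ _ => mul_nonneg (hP.nonneg _ _) (hQ.nonneg _ _)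
  sum_row s := by
    simp only [Matrix.mul_apply]
    rw [Finset.sum_comm]
    simp [← Finset.mul_sum, hQ.sum_row, hP.sum_row]

theorem IsStochastic.sum_abs_vecMul_le {P : Matrix S S ℝ} (hP : IsStochastic P) (x : S → ℝ) :
    ∑ s', |Matrix.vecMul x P s'| ≤ ∑ s, |x s| := by
  calc ∑ s', |Matrix.vecMul x P s'| ≤ ∑ s', ∑ s, |x s| * P s s' := by
        refine Finset.sum_le_sum fun s' _ => ?_
        refine (Finset.abs_sum_le_sum_abs _ _).trans_eq (Finset.sum_congr rfl fun s _ => ?_)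
        rw [abs_mul, abs_of_nonneg (hP.nonneg s s')]
    _ = ∑ s, |x s| := by
        rw [Finset.sum_comm]
        simp [← Finset.mul_sum, hP.sum_row]

variable [DecidableEq S]

theorem IsStochastic.pow {P : Matrix S S ℝ} (hP : IsStochastic P) (n : ℕ) :
    IsStochastic (P ^ n) := by
  induction n with
  | zero =>
    refine ⟨fun s s' => ?_, fun s => ?_⟩
    · rw [pow_zero, Matrix.one_apply]; split_ifs <;> norm_num
    · simp [Matrix.one_apply]
  | succ n ih => rw [pow_succ]; exact ih.mul hP

theorem exists_mixed_of_mixingTime_le {P : Matrix S S ℝ} {μ : S → ℝ} {τ : ℕ}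
    (h : mixingTime P μ ≤ τ) (s : S) :
    ∃ t ≤ τ, ∑ s', |(P ^ t) s s' - μ s'| ≤ 1 / Real.exp 1 := by
  by_contra! hcon
  have h1 := (le_iSup (fun s => ⨅ t ∈ {t : ℕ | ∑ s', |(P ^ t) s s' - μ s'| ≤ 1 / Real.exp 1},
    (t : ℕ∞)) s).trans h
  have h2 : ((τ + 1 : ℕ) : ℕ∞) ≤
      ⨅ t ∈ {t : ℕ | ∑ s', |(P ^ t) s s' - μ s'| ≤ 1 / Real.exp 1}, (t : ℕ∞) := by
    refine le_iInf₂ fun t ht => ?_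
    by_contra hlt
    have : t ≤ τ := by
      have := not_le.1 hlt
      have : t < τ + 1 := by exact_mod_cast this
      omega
    exact absurd ht (not_le.2 (hcon t this))
  have h3 : ((τ + 1 : ℕ) : ℕ∞) ≤ τ := h2.trans h1
  have : τ + 1 ≤ τ := by exact_mod_cast h3
  omega

theorem vecMul_pow_eq {P : Matrix S S ℝ} {μ : S → ℝ} (hμP : Matrix.vecMul μ P = μ) (n : ℕ) :
    Matrix.vecMul μ (P ^ n) = μ := by
  induction n with
  | zero => simp
  | succ n ih => rw [pow_succ, ← Matrix.vecMul_vecMul, ih, hμP]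

theorem pow_add_sub_eq {P : Matrix S S ℝ} {μ : S → ℝ} (hμP : Matrix.vecMul μ P = μ)
    (m n : ℕ) (s : S) :
    (fun s' => (P ^ (m + n)) s s' - μ s') =
      Matrix.vecMul (fun s' => (P ^ m) s s' - μ s') (P ^ n) := by
  have : (fun s' => (P ^ m) s s' - μ s') = (P ^ m) s - μ := rfl
  rw [this, Matrix.sub_vecMul, vecMul_pow_eq hμP, pow_add]
  rfl

/-- A rate at which a chain with mixing time `τ` is contracted, after weighting. -/
def mixRate (τ : ℕ) : ℝ := 1 - 1 / (4 * τ)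

/-- Bernoulli's inequality: the rate is slow enough that `2τ` steps of it do not outpace one
halving. -/
theorem mixRate_bounds {τ : ℕ} (hτ : 0 < τ) :
    0 < mixRate τ ∧ mixRate τ < 1 ∧ 1 / 2 ≤ mixRate τ ^ (2 * τ) := by
  have h1 : (1 : ℝ) ≤ τ := by exact_mod_cast hτ
  have h2 : 1 / (4 * (τ : ℝ)) ≤ 1 / 4 := by
    apply one_div_le_one_div_of_le <;> linarith
  have h3 : 0 < 1 / (4 * (τ : ℝ)) := by positivity
  refine ⟨by unfold mixRate; linarith, by unfold mixRate; linarith, ?_⟩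
  have := one_add_mul_le_pow (a := -(1 / (4 * (τ : ℝ)))) (by linarith) (2 * τ)
  have h4 : 1 + ((2 * τ : ℕ) : ℝ) * -(1 / (4 * (τ : ℝ))) = 1 / 2 := by
    push_cast
    field_simp
    norm_num
  rw [h4] at this
  simpa [mixRate, sub_eq_add_neg] using this

/-- By time `τ` the distance is at most `1/e ≤ 1/2` from every start, and each further block of
length `τ` halves it. The exponent `2 * n` is deliberate: one factor `γ ^ n` will be spent on the
weights of the features, the other makes them square summable. -/
theorem sum_abs_pow_sub_le {P : Matrix S S ℝ} (hP : IsStochastic P) {μ : S → ℝ}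
    (hμ0 : ∀ s, 0 ≤ μ s) (hμ1 : ∑ s, μ s = 1) (hμP : Matrix.vecMul μ P = μ) {τ : ℕ}
    (hτ : 0 < τ) (hmix : mixingTime P μ ≤ τ) (n : ℕ) (s : S) :
    ∑ s', |(P ^ n) s s' - μ s'| ≤ 4 * mixRate τ ^ (2 * n) := by
  have half : ∀ s, ∑ s', |(P ^ τ) s s' - μ s'| ≤ 1 / 2 := by
    intro s
    obtain ⟨t, ht, h⟩ := exists_mixed_of_mixingTime_le hmix s
    have h1 := (hP.pow (τ - t)).sum_abs_vecMul_le (fun s' => (P ^ t) s s' - μ s')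
    rw [← pow_add_sub_eq hμP, Nat.add_sub_cancel' ht] at h1
    refine h1.trans (h.trans ?_)
    apply one_div_le_one_div_of_le (by norm_num)
    linarith [Real.exp_one_gt_d9]
  have zero : ∀ n s, ∑ s', ((P ^ n) s s' - μ s') = 0 := by
    intro n s
    rw [Finset.sum_sub_distrib, (hP.pow n).sum_row, hμ1, sub_self]
  have block : ∀ q s, ∑ s', |(P ^ (q * τ)) s s' - μ s'| ≤ 2 * (1 / 2) ^ q := by
    intro q
    induction q with
    | zero =>
      intro s
      calc ∑ s', |(P ^ (0 * τ)) s s' - μ s'| ≤ ∑ s', ((P ^ (0 * τ)) s s' + μ s') := by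
            refine Finset.sum_le_sum fun s' _ => ?_
            have := (hP.pow (0 * τ)).nonneg s s'
            have := hμ0 s'
            rw [abs_le]; constructor <;> linarith
        _ ≤ 2 * (1 / 2) ^ 0 := by
            rw [Finset.sum_add_distrib, (hP.pow _).sum_row, hμ1]; norm_num
    | succ q ih =>
      intro s
      have h1 := pow_add_sub_eq hμP (q * τ) τ s
      rw [show (q + 1) * τ = q * τ + τ by ring]
      calc ∑ s', |(P ^ (q * τ + τ)) s s' - μ s'|
          = ∑ s', |∑ r, ((P ^ (q * τ)) s r - μ r) * ((P ^ τ) r s' - μ s')| := by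
            refine Finset.sum_congr rfl fun s' _ => ?_
            have h2 : (P ^ (q * τ + τ)) s s' - μ s' = _ := congrFun h1 s'
            rw [h2]
            -- The deviation after `q * τ` steps has total mass zero, so `μ` may be subtracted from
            -- every row of `P ^ τ` at no cost.
            simp only [mul_sub, Finset.sum_sub_distrib, ← Finset.sum_mul, zero, zero_mul,
              sub_zero]
            rfl
        _ ≤ ∑ s', ∑ r, |(P ^ (q * τ)) s r - μ r| * |(P ^ τ) r s' - μ s'| := by
            refine Finset.sum_le_sum fun s' _ => ?_
            refine (Finset.abs_sum_le_sum_abs _ _).trans_eq ?_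
            simp [abs_mul]
        _ ≤ ∑ r, |(P ^ (q * τ)) s r - μ r| * (1 / 2) := by
            rw [Finset.sum_comm]
            refine Finset.sum_le_sum fun r _ => ?_
            rw [← Finset.mul_sum]
            exact mul_le_mul_of_nonneg_left (half r) (abs_nonneg _)
        _ ≤ 2 * (1 / 2) ^ (q + 1) := by
            rw [← Finset.sum_mul, pow_succ, ← mul_assoc]
            exact mul_le_mul_of_nonneg_right (ih s) (by norm_num)
  obtain ⟨hγ0, hγ1, hγτ⟩ := mixRate_bounds hτ
  have h1 := (hP.pow (n % τ)).sum_abs_vecMul_le (fun s' => (P ^ (n / τ * τ)) s s' - μ s')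
  rw [← pow_add_sub_eq hμP, Nat.div_add_mod'] at h1
  refine h1.trans ((block (n / τ) s).trans ?_)
  -- Rounding the number of blocks up makes the exponent at least `2 * n`; the extra halving turns
  -- the initial distance `2` into the constant `4`.
  have h2 : (1 / 2 : ℝ) ^ (n / τ + 1) ≤ (mixRate τ ^ (2 * τ)) ^ (n / τ + 1) := by gcongr
  have h3 : (mixRate τ ^ (2 * τ)) ^ (n / τ + 1) ≤ mixRate τ ^ (2 * n) := by
    rw [← pow_mul]
    apply pow_le_pow_of_le_one hγ0.le hγ1.le
    have := Nat.lt_mul_div_succ n hτ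
    rw [mul_assoc]
    omega
  rw [pow_succ] at h2
  linarith

end Mixing

/-! ### Feature vectors on which the ideal dynamics is a contraction -/

section Features

variable {S κ : Type*} [Fintype S] [DecidableEq S] [Fintype κ]

/-- The Hilbert space of weighted prediction sequences. -/
abbrev FeatureSpace (κ : Type*) : Type _ := lp (fun _ : ℕ × κ => ℝ) 2

omit [Fintype κ] in
theorem featureSpace_summable_sq (x : FeatureSpace κ) : Summable fun q => x q ^ 2 := by
  have := (memℓp_gen_iff (by norm_num)).1 (lp.memℓp x)
  simpa using this

omit [Fintype κ] in
theorem featureSpace_norm_sq (x : FeatureSpace κ) : ‖x‖ ^ 2 = ∑' q, x q ^ 2 := by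
  have := lp.norm_rpow_eq_tsum (p := 2) (by norm_num) x
  simpa using this

/-- The left shift multiplied by `γ`. -/
def scaledShift (κ : Type*) (γ : ℝ) : FeatureSpace κ →ₗ[ℝ] FeatureSpace κ where
  toFun x := ⟨fun q => γ * x (q.1 + 1, q.2), by
    apply memℓp_gen
    have := (featureSpace_summable_sq x).comp_injective
      (i := fun q : ℕ × κ => (q.1 + 1, q.2)) (fun a b h => by
        simp only [Prod.mk.injEq, add_left_inj] at h
        exact Prod.ext h.1 h.2)
    simpa [mul_pow] using this.mul_left (γ ^ 2)⟩
  map_add' x y := by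
    ext q
    exact mul_add _ _ _
  map_smul' c x := by
    ext q
    simp [mul_left_comm]

omit [Fintype κ] in
theorem scaledShift_apply (γ : ℝ) (x : FeatureSpace κ) (q : ℕ × κ) :
    scaledShift κ γ x q = γ * x (q.1 + 1, q.2) := rfl

omit [Fintype κ] in
theorem norm_scaledShift_le {γ : ℝ} (hγ : 0 ≤ γ) (x : FeatureSpace κ) :
    ‖scaledShift κ γ x‖ ≤ γ * ‖x‖ := by
  refine le_of_sq_le_sq ?_ (by positivity)
  rw [mul_pow, featureSpace_norm_sq, featureSpace_norm_sq]
  simp only [scaledShift_apply, mul_pow]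
  rw [tsum_mul_left]
  refine mul_le_mul_of_nonneg_left ?_ (sq_nonneg γ)
  have hinj : Function.Injective fun q : ℕ × κ => (q.1 + 1, q.2) := fun a b h => by
    simp only [Prod.mk.injEq, add_left_inj] at h
    exact Prod.ext h.1 h.2
  exact Summable.tsum_le_tsum_of_inj _ hinj (fun _ _ => sq_nonneg _) (fun _ => le_rfl)
    ((featureSpace_summable_sq x).comp_injective hinj) (featureSpace_summable_sq x)

/-- Deviation at time `n`, from its stationary value, of the expectation of `g`. -/
def predDev (P : Matrix S S ℝ) (μ : S → ℝ) (g : S → ℝ) (n : ℕ) (s : S) : ℝ :=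
  ∑ s', ((P ^ n) s s' - μ s') * g s'

theorem predDev_zero (P : Matrix S S ℝ) (μ : S → ℝ) (g : S → ℝ) (s : S) :
    predDev P μ g 0 s = g s - ∑ s', μ s' * g s' := by
  simp [predDev, sub_mul, Finset.sum_sub_distrib, Matrix.one_apply]

theorem sum_mul_predDev {P : Matrix S S ℝ} (hP : IsStochastic P) (μ : S → ℝ) (g : S → ℝ)
    (n : ℕ) (s : S) : ∑ r, P s r * predDev P μ g n r = predDev P μ g (n + 1) s := by
  simp only [predDev, Finset.mul_sum]
  rw [Finset.sum_comm]
  refine Finset.sum_congr rfl fun s' _ => ?_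
  simp only [← mul_assoc, ← Finset.sum_mul, mul_sub, Finset.sum_sub_distrib, hP.sum_row, one_mul]
  rw [pow_succ', Matrix.mul_apply]

theorem abs_predDev_le {P : Matrix S S ℝ} (hP : IsStochastic P) {μ : S → ℝ}
    (hμ0 : ∀ s, 0 ≤ μ s) (hμ1 : ∑ s, μ s = 1) (hμP : Matrix.vecMul μ P = μ) {τ : ℕ}
    (hτ : 0 < τ) (hmix : mixingTime P μ ≤ τ) {g : S → ℝ} {M : ℝ} (hg : ∀ s, |g s| ≤ M)
    (n : ℕ) (s : S) : |predDev P μ g n s| ≤ 4 * M * mixRate τ ^ (2 * n) := by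
  have hM : 0 ≤ M := (abs_nonneg _).trans (hg s)
  calc |predDev P μ g n s| ≤ ∑ s', |(P ^ n) s s' - μ s'| * M := by
        refine (Finset.abs_sum_le_sum_abs _ _).trans (Finset.sum_le_sum fun s' _ => ?_)
        rw [abs_mul]
        exact mul_le_mul_of_nonneg_left (hg s') (abs_nonneg _)
    _ ≤ (4 * mixRate τ ^ (2 * n)) * M := by
        rw [← Finset.sum_mul]
        exact mul_le_mul_of_nonneg_right (sum_abs_pow_sub_le hP hμ0 hμ1 hμP hτ hmix n s) hM
    _ = _ := by ring

/-- Coordinate `(n, k)` is `γ⁻ⁿ` times the predicted deviation of `g k` after `n` steps. Averaging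
over one transition replaces `n` by `n + 1`, which is `γ` times the shift. The decay `γ²ⁿ` of the
predictions beats the weight and leaves a geometric series. -/
theorem exists_feature {P : Matrix S S ℝ} (hP : IsStochastic P) {μ : S → ℝ}
    (hμ0 : ∀ s, 0 ≤ μ s) (hμ1 : ∑ s, μ s = 1) (hμP : Matrix.vecMul μ P = μ) {τ : ℕ}
    (hτ : 0 < τ) (hmix : mixingTime P μ ≤ τ) {g : κ → S → ℝ} {M : ℝ}
    (hg : ∀ k s, |g k s| ≤ M) :
    ∃ v : S → FeatureSpace κ,
      (∀ k s, v s (0, k) = g k s - ∑ s', μ s' * g k s') ∧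
      (∀ s, ∑ s', P s s' • v s' = scaledShift κ (mixRate τ) (v s)) ∧
      (∀ s, ‖v s‖ ^ 2 ≤ 64 * Fintype.card κ * τ * M ^ 2) := by
  obtain ⟨hγ0, hγ1, -⟩ := mixRate_bounds hτ
  have hγτ : (4 * (τ : ℝ))⁻¹ = 1 - mixRate τ := by simp [mixRate]
  have hτ' : (0 : ℝ) < τ := by exact_mod_cast hτ
  obtain ⟨γ, hγ⟩ : ∃ γ, mixRate τ = γ := ⟨_, rfl⟩
  have hpred := fun k => abs_predDev_le hP hμ0 hμ1 hμP hτ hmix (hg k)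
  rw [hγ] at hγ0 hγ1 hγτ ⊢
  simp only [hγ] at hpred
  have hγ2 : γ ^ 2 < 1 := by nlinarith
  -- Here `1 - γ² ≥ 1 - γ = 1/(4τ)`; multiplied by the bound `16 M²` on each coordinate, this is the
  -- source of the constant `64`.
  have h1 : (1 - γ ^ 2)⁻¹ ≤ 4 * (τ : ℝ) := by
    rw [inv_le_comm₀ (by linarith) (by positivity), hγτ]
    nlinarith
  obtain ⟨w, hw⟩ : ∃ w : S → ℕ × κ → ℝ,
      ∀ s q, w s q = (γ⁻¹) ^ q.1 * predDev P μ (g q.2) q.1 s := ⟨_, fun _ _ => rfl⟩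
  have hbd : ∀ s q, w s q ^ 2 ≤ (γ ^ 2) ^ q.1 * (16 * M ^ 2) := by
    intro s q
    have h1 : |w s q| ≤ 4 * M * γ ^ q.1 := by
      rw [hw, abs_mul, abs_of_nonneg (by positivity)]
      calc (γ⁻¹) ^ q.1 * |predDev P μ (g q.2) q.1 s|
          ≤ (γ⁻¹) ^ q.1 * (4 * M * γ ^ (2 * q.1)) := by
            gcongr
            exact hpred q.2 q.1 s
        _ = 4 * M * γ ^ q.1 := by
            rw [two_mul, pow_add, inv_pow]
            field_simp
    calc w s q ^ 2 = |w s q| ^ 2 := (sq_abs _).symm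
      _ ≤ (4 * M * γ ^ q.1) ^ 2 := by gcongr
      _ = _ := by rw [← pow_mul, mul_comm 2, pow_mul]; ring
  have hsum : HasSum (fun q : ℕ × κ => (γ ^ 2) ^ q.1 * (16 * M ^ 2))
      ((1 - γ ^ 2)⁻¹ * (Fintype.card κ * (16 * M ^ 2))) := by
    have h1 := hasSum_geometric_of_lt_one (sq_nonneg γ) hγ2
    have h2 : HasSum (fun _ : κ => 16 * M ^ 2) (Fintype.card κ * (16 * M ^ 2)) := by
      have := hasSum_fintype (fun _ : κ => 16 * M ^ 2)
      simpa using this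
    have h0 : (0 : ℝ) ≤ 16 * M ^ 2 := by positivity
    have h3 : Summable fun q : ℕ × κ =>
        (fun n => (γ ^ 2) ^ n) q.1 * (fun _ : κ => 16 * M ^ 2) q.2 :=
      Summable.mul_of_nonneg (f := fun n => (γ ^ 2) ^ n) (g := fun _ : κ => 16 * M ^ 2)
        h1.summable h2.summable (fun n => pow_nonneg (sq_nonneg γ) n) (fun _ => h0)
    exact HasSum.mul (f := fun n => (γ ^ 2) ^ n) (g := fun _ : κ => 16 * M ^ 2) h1 h2 h3
  have hws : ∀ s, Summable fun q => w s q ^ 2 := fun s =>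
    Summable.of_nonneg_of_le (fun q => sq_nonneg _) (hbd s) hsum.summable
  have hshift : ∀ s q, ∑ s', P s s' * w s' q = γ * w s (q.1 + 1, q.2) := by
    intro s q
    rw [hw, ← sum_mul_predDev hP, Finset.mul_sum, Finset.mul_sum]
    refine Finset.sum_congr rfl fun s' _ => ?_
    rw [hw, pow_succ]
    have : γ * γ⁻¹ = 1 := mul_inv_cancel₀ hγ0.ne'
    linear_combination (-(P s s' * (γ⁻¹) ^ q.1 * predDev P μ (g q.2) q.1 s')) * this
  have hmem : ∀ s, Memℓp (w s) 2 := fun s => memℓp_gen (by simpa using hws s)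
  refine ⟨fun s => ⟨w s, hmem s⟩, fun k s => ?_, fun s => ?_,
    fun s => ?_⟩
  · change w s (0, k) = _
    rw [hw, pow_zero, one_mul, predDev_zero]
  · ext q
    rw [scaledShift_apply, lp.coeFn_sum, Finset.sum_apply]
    exact hshift s q
  · rw [featureSpace_norm_sq]
    have h0 := hasSum_le (hbd s) (hws s).hasSum hsum
    refine le_trans h0 ?_
    calc (1 - γ ^ 2)⁻¹ * (Fintype.card κ * (16 * M ^ 2))
        ≤ 4 * τ * (Fintype.card κ * (16 * M ^ 2)) := by gcongr
      _ = _ := by ring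

end Features

/-! ### Cesàro convergence of finite Markov chains -/

section Ergodic

/-- If `y = f x - x` is fixed, then `f^[n] x = x + n y` stays bounded, which forces `y = 0`.
Rank-nullity upgrades disjointness to complementarity. -/
theorem isCompl_eqLocus_range {E : Type*} [NormedAddCommGroup E] [NormedSpace ℝ E]
    [FiniteDimensional ℝ E] (f : E →ₗ[ℝ] E) (hf : LipschitzWith 1 f) :
    IsCompl (LinearMap.eqLocus f 1) (LinearMap.range (f - 1)) := by
  have hdisj : Disjoint (LinearMap.eqLocus f 1) (LinearMap.range (f - 1)) := by
    rw [Submodule.disjoint_def]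
    rintro y hy ⟨x, hx⟩
    have hfy : f y = y := hy
    have hfx : f x = x + y := by
      rw [← hx]; simp
    have hit : ∀ n : ℕ, f^[n] x = x + (n : ℝ) • y := by
      intro n
      induction n with
      | zero => simp
      | succ n ih =>
        rw [Function.iterate_succ_apply', ih, map_add, map_smul, hfy, hfx]
        push_cast
        module
    have hn : ∀ n : ℕ, ‖f^[n] x‖ ≤ ‖x‖ := by
      intro n
      have := (hf.iterate n).dist_le_mul x 0
      have h0 : f^[n] 0 = 0 := iterate_map_zero (f : E →+ E) n
      simpa [h0] using this
    by_contra hne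
    have hy0 : 0 < ‖y‖ := norm_pos_iff.2 hne
    obtain ⟨n, hn'⟩ := exists_nat_gt (2 * ‖x‖ / ‖y‖)
    rw [div_lt_iff₀ hy0] at hn'
    have h1 : ‖(n : ℝ) • y‖ ≤ ‖f^[n] x‖ + ‖x‖ := by
      have : (n : ℝ) • y = f^[n] x - x := by rw [hit]; abel
      rw [this]
      exact norm_sub_le _ _
    rw [norm_smul, Real.norm_natCast] at h1
    linarith [hn n]
  refine ⟨hdisj, codisjoint_iff.2 ?_⟩
  apply Submodule.eq_top_of_disjoint _ _ ?_ hdisj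
  have h1 : LinearMap.eqLocus f 1 = LinearMap.ker (f - 1) := by
    ext x
    simp [LinearMap.mem_eqLocus, sub_eq_zero]
  rw [h1, add_comm]
  exact (LinearMap.finrank_range_add_finrank_ker (f - 1)).ge

theorem exists_tendsto_birkhoffAverage {E : Type*} [NormedAddCommGroup E] [NormedSpace ℝ E]
    [FiniteDimensional ℝ E] (f : E →ₗ[ℝ] E) (hf : LipschitzWith 1 f) (x : E) :
    ∃ y, Tendsto (birkhoffAverage ℝ f _root_.id · x) atTop (𝓝 y) := by
  have hc := isCompl_eqLocus_range f hf
  refine ⟨_, f.tendsto_birkhoffAverage_of_ker_subset_closure hf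
    (LinearMap.toContinuousLinearMap (Submodule.projectionOnto _ _ hc)) ?_ ?_ x⟩
  · intro z
    simp
  · refine subset_trans ?_ subset_closure
    intro z hz
    have : Submodule.projectionOnto _ _ hc z = 0 := hz
    rwa [Submodule.projectionOnto_apply_eq_zero_iff] at this

/-- The kernel acts on functions as a sup-norm contraction, and the law at time `t` tested on `g` is
the initial law tested on the `t`-th iterate of `g`. The finite-dimensional mean ergodic theorem
then applies whatever the class structure of the chain. -/
theorem exists_tendsto_cesaro_expect {X : Type*} [Fintype X] (κ : X → PMF X) (L : ℕ → PMF X)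
    (hL : ∀ t, L (t + 1) = (L t).bind κ) (g : X → ℝ) :
    ∃ R, Tendsto (fun T : ℕ => (1 / (T : ℝ)) * ∑ t ∈ Finset.range T, (L t).expect g) atTop
      (𝓝 R) := by
  let A : (X → ℝ) →ₗ[ℝ] (X → ℝ) :=
    { toFun := fun g x => (κ x).expect g
      map_add' := fun g h => funext fun x => (κ x).expect_add g h
      map_smul' := fun c g => funext fun x => (κ x).expect_smul c g }
  have hA : LipschitzWith 1 A := by
    refine LipschitzWith.of_dist_le_mul fun g h => ?_
    rw [NNReal.coe_one, one_mul, dist_eq_norm, ← map_sub, dist_eq_norm,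
      pi_norm_le_iff_of_nonneg (norm_nonneg _)]
    exact fun x => (κ x).norm_expect_le_of_le fun z => norm_le_pi_norm (g - h) z
  obtain ⟨h, hh⟩ := exists_tendsto_birkhoffAverage A hA g
  let ev : (X → ℝ) →ₗ[ℝ] ℝ :=
    { toFun := fun g => (L 0).expect g
      map_add' := fun g h => (L 0).expect_add g h
      map_smul' := fun c g => (L 0).expect_smul c g }
  have hev : ∀ t g, (L t).expect g = ev (A^[t] g) := by
    intro t
    induction t with
    | zero => intro g; rfl
    | succ t ih =>
      intro g
      rw [hL, PMF.expect_bind, Function.iterate_succ_apply]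
      exact ih (A g)
  refine ⟨ev h, ?_⟩
  have := ((LinearMap.toContinuousLinearMap ev).continuous.tendsto h).comp hh
  refine this.congr fun T => ?_
  simp [birkhoffAverage, birkhoffSum, map_sum, hev]

end Ergodic

namespace WCMDP

variable {S A : Type*} [Fintype S] [Fintype A] {K N : ℕ}

/-! ### Laws of states and actions -/

section Laws

/-- The law of the system state at time `t`. -/
def stateLaw (W : WCMDP S A K N) (π : Policy S A N) (s₀ : Fin N → S) (t : ℕ) :
    PMF (Fin N → S) :=
  (W.historyLaw π s₀ t).map Prod.snd

omit [Fintype A] in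
theorem stateLaw_succ (W : WCMDP S A K N) (π : Policy S A N) (s₀ : Fin N → S) (t : ℕ) :
    W.stateLaw π s₀ (t + 1) = (W.stateActionLaw π s₀ t).bind fun p => W.sysTrans p.1 p.2 := by
  rw [stateLaw, historyLaw, stateActionLaw, PMF.map_bind, PMF.bind_bind]
  congr 1
  funext hs
  rw [PMF.map_bind, PMF.bind_map]
  congr 1
  funext a
  rw [PMF.map_comp]
  exact PMF.map_id _

omit [Fintype A] in
theorem stateActionLaw_map_fst (W : WCMDP S A K N) (π : Policy S A N) (s₀ : Fin N → S) (t : ℕ) :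
    (W.stateActionLaw π s₀ t).map Prod.fst = W.stateLaw π s₀ t := by
  rw [stateLaw, stateActionLaw, PMF.map_bind]
  change _ = PMF.bind _ _
  congr 1
  funext hs
  rw [PMF.map_comp]
  exact PMF.map_const _ _

omit [Fintype A] in
/-- For a policy that ignores the history, the action law depends only on the state law. -/
theorem stateActionLaw_const (W : WCMDP S A K N) (q : (Fin N → S) → PMF (Fin N → A))
    (s₀ : Fin N → S) (t : ℕ) :
    W.stateActionLaw (fun _ s => q s) s₀ t =
      (W.stateLaw (fun _ s => q s) s₀ t).bind fun s => (q s).map fun a => (s, a) := by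
  unfold stateLaw stateActionLaw
  rw [PMF.bind_map]
  rfl

theorem expectedReward_eq (W : WCMDP S A K N) (π : Policy S A N) (s₀ : Fin N → S) (t : ℕ) :
    W.expectedReward π s₀ t =
      (W.stateActionLaw π s₀ t).expect fun p => ∑ i, W.reward i (p.1 i) (p.2 i) := rfl

omit [Fintype A] in
theorem expect_sysTrans_eval {V : Type*} [AddCommGroup V] [Module ℝ V] (W : WCMDP S A K N)
    (s : Fin N → S) (a : Fin N → A) (i : Fin N) (g : S → V) :
    (W.sysTrans s a).expect (fun s' => g (s' i)) = (W.trans i (s i) (a i)).expect g :=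
  prodPMF_expect_eval _ i g

end Laws

/-! ### The LP value bounds the value of every policy -/

section UpperBound

/-- Probability that arm `i` is in state `s` and takes action `a` at time `t`. -/
def occupancy (W : WCMDP S A K N) (π : Policy S A N) (s₀ : Fin N → S) (t : ℕ) (i : Fin N)
    (s : S) (a : A) : ℝ :=
  open Classical in
  (W.stateActionLaw π s₀ t).expect fun p => if p.1 i = s ∧ p.2 i = a then 1 else 0

/-- Time average of the occupancy probabilities. -/
def avgOccupancy (W : WCMDP S A K N) (π : Policy S A N) (s₀ : Fin N → S) (T : ℕ) (i : Fin N)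
    (s : S) (a : A) : ℝ :=
  (1 / (T : ℝ)) * ∑ t ∈ Finset.range T, W.occupancy π s₀ t i s a

theorem sum_occupancy_mul (W : WCMDP S A K N) (π : Policy S A N) (s₀ : Fin N → S) (t : ℕ)
    (i : Fin N) (f : S → A → ℝ) :
    ∑ s, ∑ a, W.occupancy π s₀ t i s a * f s a =
      (W.stateActionLaw π s₀ t).expect fun p => f (p.1 i) (p.2 i) := by
  classical
  have h : ∀ s a, W.occupancy π s₀ t i s a * f s a = (W.stateActionLaw π s₀ t).expect
      fun p => if p.1 i = s ∧ p.2 i = a then f s a else 0 := by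
    intro s a
    rw [occupancy, mul_comm, ← PMF.expect_const_mul]
    congr 1
    funext p
    split_ifs <;> simp
  simp only [h, ← PMF.expect_sum]
  congr 1
  funext p
  rw [Finset.sum_eq_single (p.1 i) (fun s _ hs => Finset.sum_eq_zero fun a _ => by
    simp [Ne.symm hs]) (by simp), Finset.sum_eq_single (p.2 i) (fun a _ ha => by
    simp [Ne.symm ha]) (by simp)]
  simp

theorem sum_avgOccupancy_mul (W : WCMDP S A K N) (π : Policy S A N) (s₀ : Fin N → S) (T : ℕ)
    (i : Fin N) (f : S → A → ℝ) :
    ∑ s, ∑ a, W.avgOccupancy π s₀ T i s a * f s a = (1 / (T : ℝ)) * ∑ t ∈ Finset.range T,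
      (W.stateActionLaw π s₀ t).expect fun p => f (p.1 i) (p.2 i) := by
  simp only [← sum_occupancy_mul, avgOccupancy, Finset.mul_sum, Finset.sum_mul]
  conv_rhs => rw [Finset.sum_comm]
  refine Finset.sum_congr rfl fun s _ => ?_
  conv_rhs => rw [Finset.sum_comm]
  exact Finset.sum_congr rfl fun a _ => Finset.sum_congr rfl fun t _ => by ring

theorem occupancy_mem_Icc (W : WCMDP S A K N) (π : Policy S A N) (s₀ : Fin N → S) (t : ℕ)
    (i : Fin N) (s : S) (a : A) : W.occupancy π s₀ t i s a ∈ Set.Icc (0 : ℝ) 1 := by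
  refine ⟨PMF.expect_nonneg _ fun p => ?_, PMF.expect_le_of_le _ fun p => ?_⟩ <;>
  · split_ifs <;> norm_num

theorem cesaro_const (T : ℕ) (hT : 0 < T) (c : ℝ) :
    (1 / (T : ℝ)) * ∑ _t ∈ Finset.range T, c = c := by
  have : (T : ℝ) ≠ 0 := by positivity
  simp [this]

theorem cesaro_mono (T : ℕ) {f g : ℕ → ℝ} (h : ∀ t, f t ≤ g t) :
    (1 / (T : ℝ)) * ∑ t ∈ Finset.range T, f t ≤ (1 / (T : ℝ)) * ∑ t ∈ Finset.range T, g t :=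
  mul_le_mul_of_nonneg_left (Finset.sum_le_sum fun t _ => h t) (by positivity)

theorem avgOccupancy_mem_Icc (W : WCMDP S A K N) (π : Policy S A N) (s₀ : Fin N → S) (T : ℕ) :
    W.avgOccupancy π s₀ T ∈ Set.Icc (0 : Fin N → S → A → ℝ) 1 := by
  refine ⟨fun i s a => ?_, fun i s a => ?_⟩
  · exact mul_nonneg (by positivity)
      (Finset.sum_nonneg fun t _ => (W.occupancy_mem_Icc π s₀ t i s a).1)
  · rcases Nat.eq_zero_or_pos T with hT | hT
    · simp [avgOccupancy, hT]
    · exact (cesaro_mono T fun t => (W.occupancy_mem_Icc π s₀ t i s a).2).trans_eq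
        (cesaro_const T hT 1)

theorem avgReward_eq_lpValue (W : WCMDP S A K N) (π : Policy S A N) (s₀ : Fin N → S) (T : ℕ) :
    W.avgReward π s₀ T = W.lpValue (W.avgOccupancy π s₀ T) := by
  simp only [avgReward, lpValue, sum_avgOccupancy_mul, expectedReward_eq, PMF.expect_sum,
    ← Finset.mul_sum]
  rw [mul_left_comm]
  congr 2
  exact Finset.sum_comm

theorem expect_mono_of_support {α : Type*} [Fintype α] (p : PMF α) {f : α → ℝ} {c : ℝ}
    (h : ∀ a ∈ p.support, f a ≤ c) : p.expect f ≤ c := by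
  rw [← p.expect_const c]
  refine Finset.sum_le_sum fun a _ => ?_
  by_cases ha : a ∈ p.support
  · exact mul_le_mul_of_nonneg_left (h a ha) ENNReal.toReal_nonneg
  · rw [PMF.mem_support_iff, not_not] at ha
    simp [ha]

/-- The defect telescopes to the difference of two state probabilities, divided by `T`. -/
theorem avgOccupancy_stationary_defect (W : WCMDP S A K N) (π : Policy S A N) (s₀ : Fin N → S)
    (T : ℕ) (i : Fin N) (s : S) :
    |∑ s', ∑ a', (W.trans i s' a' s).toReal * W.avgOccupancy π s₀ T i s' a' -
      ∑ a, W.avgOccupancy π s₀ T i s a| ≤ 1 / T := by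
  classical
  set m : ℕ → ℝ := fun t => (W.stateLaw π s₀ t).expect fun x => if x i = s then 1 else 0 with hm
  have hm01 : ∀ t, m t ∈ Set.Icc (0 : ℝ) 1 := fun t =>
    ⟨PMF.expect_nonneg _ fun p => by split_ifs <;> norm_num,
      PMF.expect_le_of_le _ fun p => by split_ifs <;> norm_num⟩
  have h1 : ∑ s', ∑ a', (W.trans i s' a' s).toReal * W.avgOccupancy π s₀ T i s' a' =
      (1 / (T : ℝ)) * ∑ t ∈ Finset.range T, m (t + 1) := by
    have := W.sum_avgOccupancy_mul π s₀ T i fun s' a' => (W.trans i s' a' s).toReal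
    simp only [mul_comm _ (ENNReal.toReal _)] at this
    rw [this]
    congr 1
    refine Finset.sum_congr rfl fun t _ => ?_
    simp only [hm]
    rw [stateLaw_succ, PMF.expect_bind]
    congr 1
    funext p
    rw [expect_sysTrans_eval W p.1 p.2 i fun x => if x = s then (1 : ℝ) else 0]
    simp [PMF.expect]
  have h2 : ∑ a, W.avgOccupancy π s₀ T i s a = (1 / (T : ℝ)) * ∑ t ∈ Finset.range T, m t := by
    have := W.sum_avgOccupancy_mul π s₀ T i fun s' _ => if s' = s then 1 else 0
    rw [Finset.sum_eq_single s (fun s' _ hs' => by simp [hs']) (by simp)] at this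
    simp only [if_true, mul_one] at this
    rw [this]
    congr 1
    refine Finset.sum_congr rfl fun t _ => ?_
    simp only [hm]
    rw [← stateActionLaw_map_fst, PMF.expect_map]
  rw [h1, h2, ← mul_sub, ← Finset.sum_sub_distrib, Finset.sum_range_sub, abs_mul,
    abs_of_nonneg (by positivity)]
  refine mul_le_of_le_one_right (by positivity) ?_
  have := hm01 T
  have := hm01 0
  simp only [Set.mem_Icc] at *
  rw [abs_le]; constructor <;> linarith

theorem avgOccupancy_budget (W : WCMDP S A K N) (π : Policy S A N) (s₀ : Fin N → S)
    (hπ : W.IsFeasible π s₀) (hN : 0 < N) (T : ℕ) (k : Fin K) :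
    (1 / (N : ℝ)) * ∑ i, ∑ s, ∑ a, W.avgOccupancy π s₀ T i s a * W.cost k i s a ≤
      W.budget k := by
  have hN' : (0 : ℝ) < N := by exact_mod_cast hN
  rw [one_div, inv_mul_le_iff₀ hN']
  simp only [sum_avgOccupancy_mul, ← Finset.mul_sum]
  rw [Finset.sum_comm]
  simp only [← PMF.expect_sum]
  -- At `T = 0` the average is `0` because `1 / 0 = 0`, and the bound holds since budgets are
  -- positive.
  rcases Nat.eq_zero_or_pos T with hT | hT
  · simp only [hT, Finset.range_zero, Finset.sum_empty, mul_zero]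
    exact mul_nonneg hN'.le (W.budget_pos k).le
  · refine (cesaro_mono T fun t => ?_).trans_eq (cesaro_const T hT _)
    refine expect_mono_of_support _ fun p hp => ?_
    rw [mul_comm]
    exact hπ t p hp k

theorem continuous_lpValue (W : WCMDP S A K N) : Continuous W.lpValue := by
  unfold lpValue
  fun_prop

/-- The average reward is the LP objective at the averaged occupancies. Any subsequential limit of
these is LP-feasible, so the average reward is frequently below the LP optimum plus `ε`. -/
theorem liminfReward_le_lpValue (W : WCMDP S A K N) {y : Fin N → S → A → ℝ}
    (hy : W.IsLPOptimal y) (hN : 0 < N) (π : Policy S A N) (s₀ : Fin N → S)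
    (hπ : W.IsFeasible π s₀) : W.liminfReward π s₀ ≤ W.lpValue y := by
  obtain ⟨z, hz, φ, hφ, hlim⟩ := (isCompact_Icc (a := (0 : Fin N → S → A → ℝ))
    (b := 1)).tendsto_subseq (W.avgOccupancy_mem_Icc π s₀)
  have hcoord : ∀ i s a, Tendsto (fun n => W.avgOccupancy π s₀ (φ n) i s a) atTop
      (𝓝 (z i s a)) := fun i s a =>
    (tendsto_pi_nhds.1 ((tendsto_pi_nhds.1 ((tendsto_pi_nhds.1 hlim) i)) s)) a
  have hzf : W.IsLPFeasible z := by
    refine ⟨fun i s a => hz.1 i s a, fun i => ?_, fun i s => ?_, fun k => ?_⟩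
    · have h1 : Tendsto (fun n => ∑ s, ∑ a, W.avgOccupancy π s₀ (φ n) i s a) atTop
          (𝓝 (∑ s, ∑ a, z i s a)) :=
        tendsto_finsetSum _ fun s _ => tendsto_finsetSum _ fun a _ => hcoord i s a
      refine tendsto_nhds_unique h1 (tendsto_const_nhds.congr' ?_)
      filter_upwards [eventually_ge_atTop 1] with n hn
      have := W.sum_avgOccupancy_mul π s₀ (φ n) i fun _ _ => 1
      simp only [mul_one, PMF.expect_const] at this
      rw [this, cesaro_const _ (hn.trans hφ.le_apply)]
    · have h1 : Tendsto (fun n => ∑ s', ∑ a', (W.trans i s' a' s).toReal *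
          W.avgOccupancy π s₀ (φ n) i s' a' - ∑ a, W.avgOccupancy π s₀ (φ n) i s a) atTop
          (𝓝 (∑ s', ∑ a', (W.trans i s' a' s).toReal * z i s' a' - ∑ a, z i s a)) :=
        (tendsto_finsetSum _ fun s' _ => tendsto_finsetSum _ fun a' _ =>
          (hcoord i s' a').const_mul _).sub (tendsto_finsetSum _ fun a _ => hcoord i s a)
      have h2 : Tendsto (fun n => 1 / ((φ n : ℕ) : ℝ)) atTop (𝓝 0) :=
        tendsto_one_div_atTop_nhds_zero_nat.comp hφ.tendsto_atTop
      have h3 := squeeze_zero_norm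
        (fun n => (Real.norm_eq_abs _).trans_le
          (W.avgOccupancy_stationary_defect π s₀ (φ n) i s)) h2
      exact sub_eq_zero.1 (tendsto_nhds_unique h1 h3)
    · have h1 : Tendsto (fun n => (1 / (N : ℝ)) * ∑ i, ∑ s, ∑ a,
          W.avgOccupancy π s₀ (φ n) i s a * W.cost k i s a) atTop
          (𝓝 ((1 / (N : ℝ)) * ∑ i, ∑ s, ∑ a, z i s a * W.cost k i s a)) :=
        (tendsto_finsetSum _ fun i _ => tendsto_finsetSum _ fun s _ =>
          tendsto_finsetSum _ fun a _ => (hcoord i s a).mul_const _).const_mul _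
      exact le_of_tendsto' h1 fun n => W.avgOccupancy_budget π s₀ hπ hN (φ n) k
  refine le_trans ?_ (hy.2 z hzf)
  have hconv : Tendsto (fun n => W.avgReward π s₀ (φ n)) atTop (𝓝 (W.lpValue z)) := by
    simp only [avgReward_eq_lpValue]
    exact (W.continuous_lpValue.tendsto z).comp hlim
  refine le_of_forall_pos_le_add fun ε hε => ?_
  refine liminf_le_of_frequently_le ?_ ?_
  · have h1 : ∀ᶠ n in atTop, W.avgReward π s₀ (φ n) ≤ W.lpValue z + ε :=
      (hconv.eventually (ge_mem_nhds (by linarith : W.lpValue z < W.lpValue z + ε)))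
    exact hφ.tendsto_atTop.frequently h1.frequently
  -- A real `liminf` is controlled only for sequences bounded below; the continuous objective is
  -- bounded on the compact cube.
  · obtain ⟨b, hb⟩ := ((isCompact_Icc (a := (0 : Fin N → S → A → ℝ)) (b := 1)).image
      W.continuous_lpValue).bddBelow
    refine isBoundedUnder_of ⟨b, fun T => ?_⟩
    rw [avgReward_eq_lpValue]
    exact hb ⟨_, W.avgOccupancy_mem_Icc π s₀ T, rfl⟩

/-- A feasible policy is required because the real supremum of the empty set is `0`, which need not
be below the LP value. -/
theorem optimalValue_le_lpValue (W : WCMDP S A K N) {y : Fin N → S → A → ℝ}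
    (hy : W.IsLPOptimal y) (hN : 0 < N) (s₀ : Fin N → S)
    (hne : ∃ π : Policy S A N, W.IsFeasible π s₀) : W.optimalValue s₀ ≤ W.lpValue y := by
  obtain ⟨π, hπ⟩ := hne
  refine csSup_le ⟨_, π, hπ, rfl⟩ ?_
  rintro x ⟨π', hπ', rfl⟩
  exact W.liminfReward_le_lpValue hy hN π' s₀ hπ'

end UpperBound

end WCMDP

namespace WCMDP

variable {S A : Type*} [Fintype S] [Fintype A] {K N : ℕ}

/-! ### Single-armed policies -/

section SingleArm

theorem singleArmPolicy_toReal (W : WCMDP S A K N) (y : Fin N → S → A → ℝ)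
    (hy : ∀ i s a, 0 ≤ y i s a) (i : Fin N) (s : S) (a : A) :
    (W.singleArmPolicy y hy i s a).toReal = singleArmProb y i s a := by
  rw [singleArmPolicy, PMF.ofFintype_apply, ENNReal.toReal_ofReal (singleArmProb_nonneg y hy i s a)]

-- At states of zero mass both sides vanish, so the default action law there plays no role.
omit [Fintype S] in
theorem stateDist_mul_singleArmProb {y : Fin N → S → A → ℝ} (hy : ∀ i s a, 0 ≤ y i s a)
    (i : Fin N) (s : S) (a : A) : stateDist y i s * singleArmProb y i s a = y i s a := by
  unfold stateDist singleArmProb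
  split_ifs with h
  · field_simp
  · have h0 : ∑ b, y i s b = 0 :=
      le_antisymm (not_lt.1 h) (Finset.sum_nonneg fun b _ => hy i s b)
    rw [h0, zero_mul]
    exact ((Finset.sum_eq_zero_iff_of_nonneg fun b _ => hy i s b).1 h0 a (Finset.mem_univ a)).symm

theorem sum_stateDist_mul_expect {W : WCMDP S A K N} {y : Fin N → S → A → ℝ}
    (hy : ∀ i s a, 0 ≤ y i s a) (i : Fin N) (f : S → A → ℝ) :
    ∑ s, stateDist y i s * (W.singleArmPolicy y hy i s).expect (f s) =
      ∑ s, ∑ a, y i s a * f s a := by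
  refine Finset.sum_congr rfl fun s _ => ?_
  rw [PMF.expect, Finset.mul_sum]
  refine Finset.sum_congr rfl fun a _ => ?_
  rw [singleArmPolicy_toReal, smul_eq_mul, ← mul_assoc, stateDist_mul_singleArmProb hy]

theorem expect_expect_trans {V : Type*} [AddCommGroup V] [Module ℝ V] (W : WCMDP S A K N)
    {y : Fin N → S → A → ℝ} (hy : ∀ i s a, 0 ≤ y i s a) (i : Fin N) (s : S) (v : S → V) :
    (W.singleArmPolicy y hy i s).expect (fun a => (W.trans i s a).expect v) =
      ∑ s', W.singleArmMatrix y i s s' • v s' := by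
  simp only [PMF.expect, Finset.smul_sum, singleArmPolicy_toReal, singleArmMatrix,
    Matrix.of_apply, Finset.sum_smul, smul_smul]
  rw [Finset.sum_comm]
  simp only [mul_comm]

theorem isStochastic_singleArmMatrix (W : WCMDP S A K N) {y : Fin N → S → A → ℝ}
    (hy : ∀ i s a, 0 ≤ y i s a) (i : Fin N) : IsStochastic (W.singleArmMatrix y i) where
  nonneg s s' := Finset.sum_nonneg fun a _ =>
    mul_nonneg ENNReal.toReal_nonneg (singleArmProb_nonneg y hy i s a)
  sum_row s := by
    have := W.expect_expect_trans hy i s fun _ => (1 : ℝ)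
    simp only [PMF.expect_const, smul_eq_mul, mul_one] at this
    exact this.symm

omit [Fintype S] in
theorem stateDist_nonneg {y : Fin N → S → A → ℝ} (hy : ∀ i s a, 0 ≤ y i s a) (i : Fin N)
    (s : S) : 0 ≤ stateDist y i s := Finset.sum_nonneg fun a _ => hy i s a

theorem vecMul_stateDist {W : WCMDP S A K N} {y : Fin N → S → A → ℝ} (hy : W.IsLPFeasible y)
    (i : Fin N) : Matrix.vecMul (stateDist y i) (W.singleArmMatrix y i) = stateDist y i := by
  funext s
  refine Eq.trans ?_ (hy.stationary i s)
  simp only [Matrix.vecMul, dotProduct, singleArmMatrix, Matrix.of_apply, Finset.mul_sum]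
  refine Finset.sum_congr rfl fun s' _ => Finset.sum_congr rfl fun a _ => ?_
  rw [mul_left_comm, stateDist_mul_singleArmProb hy.nonneg]

theorem meanCost_nonneg {W : WCMDP S A K N} {y : Fin N → S → A → ℝ}
    (hy : ∀ i s a, 0 ≤ y i s a) (k : Fin K) (i : Fin N) : 0 ≤ W.meanCost y k i :=
  Finset.sum_nonneg fun s _ => Finset.sum_nonneg fun a _ =>
    mul_nonneg (hy i s a) (W.cost_nonneg k i s a)

theorem meanCost_le {W : WCMDP S A K N} {y : Fin N → S → A → ℝ} (hy : W.IsLPFeasible y)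
    {cmax : ℝ} (hc : ∀ k i s a, W.cost k i s a ≤ cmax) (k : Fin K) (i : Fin N) :
    W.meanCost y k i ≤ cmax := by
  calc W.meanCost y k i ≤ ∑ s, ∑ a, y i s a * cmax :=
        Finset.sum_le_sum fun s _ => Finset.sum_le_sum fun a _ =>
          mul_le_mul_of_nonneg_left (hc k i s a) (hy.nonneg i s a)
    _ = cmax := by simp only [← Finset.sum_mul, hy.sum_eq_one, one_mul]

theorem sum_meanCost_le {W : WCMDP S A K N} {y : Fin N → S → A → ℝ} (hy : W.IsLPFeasible y)
    (hN : 0 < N) (k : Fin K) : ∑ i, W.meanCost y k i ≤ W.budget k * N := by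
  have := hy.budget_le k
  rwa [one_div, inv_mul_le_iff₀ (by exact_mod_cast hN), mul_comm] at this

end SingleArm

/-! ### ID reassignment -/

section Reassignment

omit [Fintype S] [Fintype A] in
theorem minBudget_le (W : WCMDP S A K N) (k : Fin K) : W.minBudget ≤ W.budget k :=
  ciInf_le (Set.finite_range _).bddBelow k

omit [Fintype S] [Fintype A] in
theorem minBudget_pos (W : WCMDP S A K N) (hK : 0 < K) : 0 < W.minBudget := by
  have : Nonempty (Fin K) := ⟨⟨0, hK⟩⟩
  obtain ⟨k, hk⟩ := exists_eq_ciInf_of_finite (f := W.budget)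
  rw [minBudget, ← hk]
  exact W.budget_pos k

/-- `σ'` extends the partial assignment `σ`. -/
def Extends (σ σ' : Fin N → Option ℕ) : Prop := ∀ i p, σ i = some p → σ' i = some p

theorem Extends.trans {σ₁ σ₂ σ₃ : Fin N → Option ℕ} (h : Extends σ₁ σ₂) (h' : Extends σ₂ σ₃) :
    Extends σ₁ σ₃ := fun i p hp => h' i p (h i p hp)

theorem extends_update {σ : Fin N → Option ℕ} {i : Fin N} (hi : σ i = none) (p : ℕ) :
    Extends σ (Function.update σ i (some p)) := by
  intro i' p' h
  have : i' ≠ i := by rintro rfl; rw [hi] at h; cases h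
  rwa [Function.update_of_ne this]

variable {W : WCMDP S A K N} {cmax : ℝ} {y : Fin N → S → A → ℝ}

theorem groupCost_mono (hy : ∀ i s a, 0 ≤ y i s a) (ℓ : ℕ) (k : Fin K)
    {σ σ' : Fin N → Option ℕ} (h : Extends σ σ') :
    W.groupCost cmax y ℓ k σ ≤ W.groupCost cmax y ℓ k σ' := by
  classical
  unfold groupCost
  refine Finset.sum_le_sum fun i _ => ?_
  split_ifs with h1 h2 h2
  · exact le_rfl
  · obtain ⟨p, hp, hp'⟩ := h1
    exact absurd ⟨p, h i p hp, hp'⟩ h2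
  · exact meanCost_nonneg hy k i
  · exact le_rfl

theorem meanCost_le_groupCost (hy : ∀ i s a, 0 ≤ y i s a) {ℓ : ℕ} (k : Fin K)
    {σ : Fin N → Option ℕ} {i : Fin N} {p : ℕ} (hi : σ i = some p)
    (hp : ℓ * W.groupSize cmax ≤ p) (hp' : p < (ℓ + 1) * W.groupSize cmax) :
    W.meanCost y k i ≤ W.groupCost cmax y ℓ k σ := by
  classical
  unfold groupCost
  refine le_trans ?_ (Finset.single_le_sum (fun j _ => ?_) (Finset.mem_univ i))
  · rw [if_pos ⟨p, hi, hp, hp'⟩]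
  · split_ifs
    · exact meanCost_nonneg hy k j
    · exact le_rfl

/-- A treated constraint has reached the threshold, either already or through the arm just picked,
and later picks only add cost. The length condition keeps every ID handed out inside the group. -/
theorem runList_assignStep (hy : ∀ i s a, 0 ≤ y i s a) (ℓ : ℕ) :
    ∀ (l : List (Fin K)) (σ σ' : Fin N → Option ℕ) (j j' : ℕ),
      RunList (W.AssignStep cmax y ℓ) l (σ, j) (σ', j') →
      ℓ * W.groupSize cmax ≤ j → j + l.length ≤ (ℓ + 1) * W.groupSize cmax →
      Extends σ σ' ∧ ∀ k ∈ l, W.threshold ≤ W.groupCost cmax y ℓ k σ' := by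
  intro l
  induction l with
  | nil =>
    intro σ σ' j j' h _ _
    obtain ⟨rfl, rfl⟩ := Prod.mk.inj h
    exact ⟨fun i p hp => hp, by simp⟩
  | cons k l ih =>
    rintro σ σ' j j' ⟨⟨σ₁, j₁⟩, ⟨h1, h2⟩, hrun⟩ hj hlen
    rw [List.length_cons] at hlen
    obtain ⟨hext, hcost, hj₁, hj₁'⟩ : Extends σ σ₁ ∧ W.threshold ≤ W.groupCost cmax y ℓ k σ₁ ∧
        j ≤ j₁ ∧ j₁ ≤ j + 1 := by
      rcases lt_or_ge (W.groupCost cmax y ℓ k σ) W.threshold with hlt | hge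
      · obtain ⟨i, hi, hnone, heq⟩ := h1 hlt
        obtain ⟨rfl, rfl⟩ := Prod.mk.inj heq
        refine ⟨extends_update hnone j, hi.trans ?_, by simp, le_rfl⟩
        exact meanCost_le_groupCost hy k (Function.update_self _ _ _) hj (by dsimp only; omega)
      · obtain ⟨rfl, rfl⟩ := Prod.mk.inj (h2 hge)
        exact ⟨fun i p hp => hp, hge, le_rfl, by omega⟩
    obtain ⟨hext', hl⟩ := ih σ₁ σ' j₁ j' hrun (by omega) (by omega)
    refine ⟨hext.trans hext', fun k' hk' => ?_⟩
    rcases List.mem_cons.1 hk' with rfl | hk'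
    · exact hcost.trans (groupCost_mono hy ℓ k' hext')
    · exact hl k' hk'

theorem runList_groupStep (hy : ∀ i s a, 0 ≤ y i s a) (hd : K ≤ W.groupSize cmax) :
    ∀ (L : List ℕ) (σ σ' : Fin N → Option ℕ), RunList (W.GroupStep cmax y) L σ σ' →
      Extends σ σ' ∧ ∀ ℓ ∈ L, ∀ k, W.IsActive y k →
        W.threshold ≤ W.groupCost cmax y ℓ k σ' := by
  intro L
  induction L with
  | nil =>
    rintro σ σ' rfl
    exact ⟨fun i p hp => hp, by simp⟩
  | cons ℓ L ih =>
    rintro σ σ' ⟨σ₁, ⟨l, hnd, hl, j', hrun⟩, hrun'⟩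
    have hlen : l.length ≤ K := by simpa using hnd.length_le_card
    obtain ⟨h1, h2⟩ := runList_assignStep hy ℓ l σ σ₁ _ j' hrun le_rfl
      (by rw [add_mul, one_mul]; omega)
    obtain ⟨h3, h4⟩ := ih σ₁ σ' hrun'
    refine ⟨h1.trans h3, fun ℓ' hℓ' k hk => ?_⟩
    rcases List.mem_cons.1 hℓ' with rfl | hℓ'
    · exact (h2 k ((hl k).2 hk)).trans (groupCost_mono hy _ k h3)
    · exact h4 ℓ' hℓ' k hk

theorem le_groupSize (hK : 0 < K) (hc : W.minBudget / 2 ≤ cmax) : K ≤ W.groupSize cmax := by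
  have ha := W.minBudget_pos hK
  have : (K : ℝ) ≤ W.groupSize cmax := by
    refine le_trans ?_ (Nat.le_ceil _)
    unfold threshold
    rw [le_div_iff₀ (by linarith), mul_comm]
    exact mul_le_mul_of_nonneg_right (by linarith) (by positivity)
  exact_mod_cast this

/-- Since `minBudget / 2 - threshold = threshold`, this is the rounding-up in the group size. It
ensures that `K` picks per group never exhaust the costly arms. -/
theorem groupSize_mul_threshold_ge (hK : 0 < K) :
    (cmax - W.threshold) * K ≤ W.groupSize cmax * W.threshold := by
  have ha := W.minBudget_pos hK
  have h := Nat.le_ceil ((cmax - W.threshold) * K / (W.minBudget / 2 - W.threshold))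
  rw [div_le_iff₀ (by unfold threshold; linarith)] at h
  refine h.trans_eq ?_
  rw [groupSize]
  congr 1
  unfold threshold
  ring

/-- Upper bound for the group size. -/
theorem groupSize_mul_threshold_le (hK : 0 < K) (hc : W.minBudget / 2 ≤ cmax) :
    W.groupSize cmax * W.threshold ≤ cmax * K := by
  have ha := W.minBudget_pos hK
  have hK1 : (1 : ℝ) ≤ K := by exact_mod_cast hK
  have hδ : 0 < W.threshold := by unfold threshold; linarith
  have hden : W.minBudget / 2 - W.threshold = W.threshold := by unfold threshold; ring
  have h := (Nat.ceil_lt_add_one (a := (cmax - W.threshold) * K /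
    (W.minBudget / 2 - W.threshold)) (by
      rw [hden]
      have : 0 ≤ cmax - W.threshold := by unfold threshold; linarith
      positivity)).le
  calc (W.groupSize cmax : ℝ) * W.threshold
      ≤ ((cmax - W.threshold) * K / W.threshold + 1) * W.threshold := by
        rw [hden] at h
        rw [groupSize, hden]
        exact mul_le_mul_of_nonneg_right h hδ.le
    _ = cmax * K - W.threshold * (K - 1) := by field_simp; ring
    _ ≤ cmax * K := by
        have : 0 ≤ W.threshold * (K - 1) := mul_nonneg hδ.le (by linarith)
        linarith

theorem minBudget_half_le_of_isActive (hy : W.IsLPFeasible y)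
    (hc : ∀ k i s a, W.cost k i s a ≤ cmax) (hN : 0 < N) {k : Fin K} (hk : W.IsActive y k) :
    W.minBudget / 2 ≤ cmax := by
  have hN' : (0 : ℝ) < N := by exact_mod_cast hN
  have h1 : ∑ i, W.meanCost y k i ≤ N * cmax :=
    (Finset.sum_le_sum fun i _ => meanCost_le hy hc k i).trans_eq (by simp)
  have h2 : W.budget k / 2 * N ≤ cmax * N := by
    rw [mul_comm cmax]; exact le_trans hk h1
  have := le_of_mul_le_mul_right h2 hN'
  linarith [W.minBudget_le k]

/-- There are enough arms with a large mean cost of each active type. -/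
theorem mul_le_card_of_isActive (hy : W.IsLPFeasible y) (hc : ∀ k i s a, W.cost k i s a ≤ cmax)
    (hK : 0 < K) (hN : 0 < N) {k : Fin K} (hk : W.IsActive y k) :
    N / W.groupSize cmax * K ≤ (Finset.univ.filter fun i => W.threshold ≤ W.meanCost y k i).card := by
  classical
  have hcm := minBudget_half_le_of_isActive hy hc hN hk
  have ha := W.minBudget_pos hK
  have hδ : 0 < W.threshold := by unfold threshold; linarith
  have hcd : 0 < cmax - W.threshold := by unfold threshold; linarith
  set n := (Finset.univ.filter fun i => W.threshold ≤ W.meanCost y k i).card with hn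
  have h1 : ∑ i, W.meanCost y k i ≤ N * W.threshold + n * (cmax - W.threshold) := by
    calc ∑ i, W.meanCost y k i ≤ ∑ i, (W.threshold +
          if W.threshold ≤ W.meanCost y k i then cmax - W.threshold else 0) := by
          refine Finset.sum_le_sum fun i _ => ?_
          have := meanCost_le hy hc k i
          split_ifs with h <;> linarith
      _ = _ := by
          rw [Finset.sum_add_distrib, ← Finset.sum_filter]
          simp [hn]
          ring
  -- An active type has total mean cost at least `2δN`. Counting `δ` for every arm accounts for half
  -- of it, so the costly arms must supply the rest through their excess of at most `cmax - δ` each.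
  have h2 : N * W.threshold ≤ n * (cmax - W.threshold) := by
    have h3 : 2 * W.threshold * N ≤ W.budget k / 2 * N := by
      refine mul_le_mul_of_nonneg_right ?_ (by positivity)
      have := W.minBudget_le k
      unfold threshold; linarith
    have h4 : W.budget k / 2 * N ≤ _ := le_trans hk h1
    linarith
  have h5 : ((N / W.groupSize cmax : ℕ) : ℝ) * W.groupSize cmax ≤ N := by
    exact_mod_cast Nat.div_mul_le_self N (W.groupSize cmax)
  have h6 : ((N / W.groupSize cmax * K : ℕ) : ℝ) * (cmax - W.threshold) ≤
      n * (cmax - W.threshold) := by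
    push_cast
    calc ((N / W.groupSize cmax : ℕ) : ℝ) * K * (cmax - W.threshold)
        = ((N / W.groupSize cmax : ℕ) : ℝ) * ((cmax - W.threshold) * K) := by ring
      _ ≤ ((N / W.groupSize cmax : ℕ) : ℝ) * (W.groupSize cmax * W.threshold) :=
          mul_le_mul_of_nonneg_left (groupSize_mul_threshold_ge hK) (by positivity)
      _ ≤ N * W.threshold := by
          rw [← mul_assoc]
          exact mul_le_mul_of_nonneg_right h5 hδ.le
      _ ≤ _ := h2
  exact_mod_cast le_of_mul_le_mul_right h6 hcd

/-- Consistency of a partial assignment: distinct IDs, all below `j`, at most `m` of them. -/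
structure IsPartialID (σ : Fin N → Option ℕ) (j m : ℕ) : Prop where
  inj : ∀ i i' p, σ i = some p → σ i' = some p → i = i'
  lt : ∀ i p, σ i = some p → p < j
  card_le : (Finset.univ.filter fun i => σ i ≠ none).card ≤ m

theorem IsPartialID.mono {σ : Fin N → Option ℕ} {j m j' m' : ℕ} (h : IsPartialID σ j m)
    (hj : j ≤ j') (hm : m ≤ m') : IsPartialID σ j' m' :=
  ⟨h.inj, fun i p hp => (h.lt i p hp).trans_le hj, h.card_le.trans hm⟩

theorem IsPartialID.update {σ : Fin N → Option ℕ} {j m : ℕ} (h : IsPartialID σ j m)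
    (i₀ : Fin N) : IsPartialID (Function.update σ i₀ (some j)) (j + 1) (m + 1) := by
  refine ⟨fun i i' p hi hi' => ?_, fun i p hi => ?_, ?_⟩
  · by_cases h1 : i = i₀ <;> by_cases h2 : i' = i₀
    · rw [h1, h2]
    · subst h1
      rw [Function.update_self] at hi
      rw [Function.update_of_ne h2] at hi'
      cases hi
      exact absurd (h.lt _ _ hi') (lt_irrefl _)
    · subst h2
      rw [Function.update_self] at hi'
      rw [Function.update_of_ne h1] at hi
      cases hi'
      exact absurd (h.lt _ _ hi) (lt_irrefl _)
    · rw [Function.update_of_ne h1] at hi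
      rw [Function.update_of_ne h2] at hi'
      exact h.inj i i' p hi hi'
  · by_cases h1 : i = i₀
    · subst h1
      rw [Function.update_self] at hi
      cases hi
      exact Nat.lt_succ_self _
    · rw [Function.update_of_ne h1] at hi
      exact (h.lt i p hi).trans (Nat.lt_succ_self _)
  · refine le_trans (Finset.card_le_card (t := insert i₀ (Finset.univ.filter fun i => σ i ≠ none))
      fun i hi => ?_) ((Finset.card_insert_le _ _).trans (Nat.succ_le_succ h.card_le))
    by_cases h1 : i = i₀
    · simp [h1]
    · simpa [Function.update_of_ne h1, h1] using hi

/-- Each step consumes at most one arm, and the whole run has at most `N / groupSize * K` steps.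
Each active type has at least that many costly arms, so an unassigned one is left whenever a pick is
needed. -/
theorem exists_runList_assignStep (hy : W.IsLPFeasible y)
    (hc : ∀ k i s a, W.cost k i s a ≤ cmax) (hK : 0 < K) (hN : 0 < N) (ℓ : ℕ) :
    ∀ (l : List (Fin K)) (σ : Fin N → Option ℕ) (j m : ℕ), (∀ k ∈ l, W.IsActive y k) →
      IsPartialID σ j m → m + l.length ≤ N / W.groupSize cmax * K →
      ∃ σ' j', RunList (W.AssignStep cmax y ℓ) l (σ, j) (σ', j') ∧
        IsPartialID σ' (j + l.length) (m + l.length) := by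
  intro l
  induction l with
  | nil => exact fun σ j m _ hσ _ => ⟨σ, j, rfl, hσ⟩
  | cons k l ih =>
    intro σ j m hact hσ hm
    rw [List.length_cons] at hm
    have hact' : ∀ k ∈ l, W.IsActive y k := fun k' hk' => hact k' (List.mem_cons_of_mem _ hk')
    rcases lt_or_ge (W.groupCost cmax y ℓ k σ) W.threshold with hlt | hge
    · obtain ⟨i, hi, hnone⟩ : ∃ i, W.threshold ≤ W.meanCost y k i ∧ σ i = none := by
        by_contra! hcon
        have h1 := mul_le_card_of_isActive hy hc hK hN (hact k List.mem_cons_self)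
        have h2 : (Finset.univ.filter fun i => W.threshold ≤ W.meanCost y k i).card ≤
            (Finset.univ.filter fun i => σ i ≠ none).card :=
          Finset.card_le_card fun i hi => by
            simpa using hcon i (Finset.mem_filter.1 hi).2
        have := hσ.card_le
        omega
      obtain ⟨σ', j', hrun, hσ'⟩ := ih _ (j + 1) (m + 1) hact' (hσ.update i) (by omega)
      refine ⟨σ', j', ⟨(Function.update σ i (some j), j + 1), ⟨fun _ => ⟨i, hi, hnone, rfl⟩,
        fun h => absurd hlt (not_lt.2 h)⟩, hrun⟩, hσ'.mono ?_ ?_⟩ <;>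
      · rw [List.length_cons]; omega
    · obtain ⟨σ', j', hrun, hσ'⟩ := ih σ j m hact' hσ (by omega)
      refine ⟨σ', j', ⟨(σ, j), ⟨fun h => absurd h (not_lt.2 hge), fun _ => rfl⟩, hrun⟩,
        hσ'.mono ?_ ?_⟩ <;>
      · rw [List.length_cons]; omega

theorem exists_runList_groupStep (hy : W.IsLPFeasible y)
    (hc : ∀ k i s a, W.cost k i s a ≤ cmax) (hK : 0 < K) (hN : 0 < N)
    (hd : K ≤ W.groupSize cmax) :
    ∀ (n ℓ : ℕ) (σ : Fin N → Option ℕ), ℓ + n ≤ N / W.groupSize cmax →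
      IsPartialID σ (ℓ * W.groupSize cmax) (ℓ * K) →
      ∃ σ', RunList (W.GroupStep cmax y) (List.range' ℓ n) σ σ' ∧
        IsPartialID σ' ((ℓ + n) * W.groupSize cmax) ((ℓ + n) * K) := by
  classical
  intro n
  induction n with
  | zero => exact fun ℓ σ _ hσ => ⟨σ, rfl, hσ⟩
  | succ n ih =>
    intro ℓ σ hℓ hσ
    set l := (Finset.univ.filter fun k => W.IsActive y k).toList with hl
    have hmem : ∀ k, k ∈ l ↔ W.IsActive y k := by simp [hl]
    have hnd : l.Nodup := Finset.nodup_toList _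
    have hlen : l.length ≤ K := by simpa using hnd.length_le_card
    have hmul : (ℓ + 1) * K ≤ N / W.groupSize cmax * K := Nat.mul_le_mul_right _ (by omega)
    have e1 : (ℓ + 1) * K = ℓ * K + K := by ring
    have e2 : (ℓ + 1) * W.groupSize cmax = ℓ * W.groupSize cmax + W.groupSize cmax := by ring
    obtain ⟨σ₁, j', hrun, hσ₁⟩ := exists_runList_assignStep hy hc hK hN ℓ l σ _ _
      (fun k hk => (hmem k).1 hk) hσ (by omega)
    obtain ⟨σ', hrun', hσ'⟩ := ih (ℓ + 1) σ₁ (by omega) (hσ₁.mono (by omega) (by omega))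
    refine ⟨σ', ⟨σ₁, ⟨l, hnd, hmem, j', hrun⟩, hrun'⟩, ?_⟩
    rwa [show ℓ + (n + 1) = ℓ + 1 + n by ring]

theorem exists_isReassignment (hy : W.IsLPFeasible y) (hc : ∀ k i s a, W.cost k i s a ≤ cmax)
    (hK : 0 < K) (hN : 0 < N) : ∃ e, W.IsReassignment cmax y e := by
  by_cases hact : ∃ k, W.IsActive y k
  · obtain ⟨k, hk⟩ := hact
    have hd := le_groupSize hK (minBudget_half_le_of_isActive hy hc hN hk)
    obtain ⟨σ, hrun, hσ⟩ := exists_runList_groupStep hy hc hK hN hd (N / W.groupSize cmax) 0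
      (fun _ => none) (by omega) ⟨by simp, by simp, by simp⟩
    have hlt : ∀ i p, σ i = some p → p < N := fun i p hp =>
      (hσ.lt i p hp).trans_le (by rw [zero_add]; exact Nat.div_mul_le_self _ _)
    -- The partial injection into the first `N` IDs extends to a bijection; this is the arbitrary
    -- filling of the unused IDs.
    obtain ⟨g, hg⟩ := Finset.exists_equiv_extend_of_card_eq (t := Finset.range N)
      (by simp) (s := Finset.univ.filter fun i => σ i ≠ none) (f := fun i => (σ i).getD 0)
      (by
        intro p hp
        obtain ⟨i, hi, rfl⟩ := Finset.mem_image.1 hp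
        obtain ⟨q, hq⟩ := Option.ne_none_iff_exists'.1 (Finset.mem_filter.1 hi).2
        simpa [hq] using hlt i q hq)
      (by
        intro i hi i' hi' h
        obtain ⟨q, hq⟩ := Option.ne_none_iff_exists'.1 (Finset.mem_filter.1 hi).2
        obtain ⟨q', hq'⟩ := Option.ne_none_iff_exists'.1 (Finset.mem_filter.1 hi').2
        simp only [hq, hq', Option.getD_some] at h
        subst h
        exact hσ.inj i i' _ hq hq')
    have hinj : Function.Injective fun i : Fin N => (⟨g i, Finset.mem_range.1 (g i).2⟩ : Fin N) := by
      intro i i' h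
      exact g.injective (Subtype.ext (Fin.mk.inj h))
    refine ⟨Equiv.ofBijective _ (Finite.injective_iff_bijective.1 hinj),
      fun h => absurd hk (h k), fun _ => ⟨σ, by rwa [List.range_eq_range'], fun i p hp => ?_⟩⟩
    have := hg i (by simp [hp])
    simpa [hp] using this
  · exact ⟨Equiv.refl _, fun _ => rfl, fun h => absurd h hact⟩

/-- Total mean cost of the arms whose new ID is below `n`: the unused budget grows linearly in the
number of remaining arms. -/
theorem sum_meanCost_prefix_le (hy : W.IsLPFeasible y) (hK : 0 < K) (hN : 0 < N)
    (hcm : W.minBudget / 2 ≤ cmax) {e : Equiv.Perm (Fin N)} (he : W.IsReassignment cmax y e)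
    (k : Fin K) {n : ℕ} (hn : n ≤ N) :
    ∑ i with (e i : ℕ) < n, W.meanCost y k i ≤
      W.budget k * N - (W.threshold / W.groupSize cmax * (N - n) - 2 * W.threshold) := by
  classical
  have ha := W.minBudget_pos hK
  have hδ : 0 < W.threshold := by unfold threshold; linarith
  have hdK := le_groupSize (W := W) hK hcm
  set d := W.groupSize cmax with hd
  have hd0 : 0 < d := by omega
  have hd1 : (1 : ℝ) ≤ d := by exact_mod_cast hd0
  have hN' : (0 : ℝ) < N := by exact_mod_cast hN
  have hnN : (n : ℝ) ≤ N := by exact_mod_cast hn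
  have hC := meanCost_nonneg (W := W) hy.nonneg k
  by_cases hk : W.IsActive y k
  · obtain ⟨σ, hrun, hσ⟩ := he.2 ⟨k, hk⟩
    have hgroup := (runList_groupStep hy.nonneg hdK _ _ _ hrun).2
    have hsplit := Finset.sum_filter_add_sum_filter_not Finset.univ
      (fun i => (e i : ℕ) < n) (fun i => W.meanCost y k i)
    have htot := sum_meanCost_le hy hN k
    set G := N / d with hG
    -- Groups `l₀, …, G - 1` lie entirely beyond the prefix. The group cut by `n` and the incomplete
    -- last group are dropped, which costs the term `2 * threshold`.
    set l₀ := n / d + 1 with hl₀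
    have hGR : (N : ℝ) / d - 1 ≤ G := by
      rw [sub_le_iff_le_add, div_le_iff₀ (by linarith)]
      have := (Nat.lt_mul_div_succ N hd0).le
      rw [mul_comm] at this
      exact_mod_cast this
    have hlR : (l₀ : ℝ) ≤ n / d + 1 := by
      rw [hl₀]; push_cast
      linarith [Nat.cast_div_le (α := ℝ) (m := n) (n := d)]
    have hlow : W.threshold * (G - l₀ : ℝ) ≤
        ∑ i with ¬ (e i : ℕ) < n, W.meanCost y k i := by
      have h1 : ∑ ℓ ∈ Finset.Ico l₀ G, W.threshold ≤ ∑ ℓ ∈ Finset.Ico l₀ G,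
          ∑ i ∈ Finset.univ.filter (fun i : Fin N => l₀ ≤ (e i : ℕ) / d ∧ (e i : ℕ) / d < G)
            with (e i : ℕ) / d = ℓ, W.meanCost y k i := by
        refine Finset.sum_le_sum fun ℓ hℓ => ?_
        rw [Finset.mem_Ico] at hℓ
        refine (hgroup ℓ (List.mem_range.2 hℓ.2) k hk).trans ?_
        rw [groupCost, ← Finset.sum_filter]
        refine Finset.sum_le_sum_of_subset_of_nonneg (fun i hi => ?_) fun i _ _ => hC i
        obtain ⟨p, hp, hp1, hp2⟩ := (Finset.mem_filter.1 hi).2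
        have hep := hσ i p hp
        have : (e i : ℕ) / d = ℓ := by
          rw [hep]
          exact Nat.div_eq_of_lt_le hp1 hp2
        simp only [Finset.mem_filter, Finset.mem_univ, true_and]
        omega
      rw [Finset.sum_fiberwise_of_maps_to (fun i hi => by
        simpa [Finset.mem_Ico] using (Finset.mem_filter.1 hi).2)] at h1
      rw [Finset.sum_const, Nat.card_Ico, nsmul_eq_mul] at h1
      have h2 : ((G : ℝ) - l₀) ≤ ((G - l₀ : ℕ) : ℝ) := by
        rw [sub_le_iff_le_add]
        exact_mod_cast le_tsub_add
      calc W.threshold * (G - l₀ : ℝ) ≤ ((G - l₀ : ℕ) : ℝ) * W.threshold := by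
            rw [mul_comm]; exact mul_le_mul_of_nonneg_right h2 hδ.le
        _ ≤ _ := h1
        _ ≤ _ := by
            refine Finset.sum_le_sum_of_subset_of_nonneg (fun i hi => ?_) fun i _ _ => hC i
            simp only [Finset.mem_filter, Finset.mem_univ, true_and, not_lt] at hi ⊢
            by_contra hlt
            have := Nat.div_le_div_right (c := d) (not_le.1 hlt).le
            omega
    have hmul : W.threshold / d * (N - n) - 2 * W.threshold ≤ W.threshold * (G - l₀ : ℝ) := by
      have : W.threshold / d * (N - n) - 2 * W.threshold =
          W.threshold * ((N : ℝ) / d - 1 - (n / d + 1)) := by field_simp; ring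
      rw [this]
      exact mul_le_mul_of_nonneg_left (by linarith) hδ.le
    linarith
  · have h1 : ∑ i with (e i : ℕ) < n, W.meanCost y k i ≤ ∑ i, W.meanCost y k i :=
      Finset.sum_le_sum_of_subset_of_nonneg (Finset.filter_subset _ _) fun i _ _ => hC i
    have h2 := not_le.1 hk
    -- An inactive type leaves at least half of its budget free, more than the slack claimed.
    have h3 : W.threshold / d * (N - n) ≤ W.budget k / 4 * N := by
      have h4 : W.threshold / d ≤ W.budget k / 4 := by
        rw [div_le_iff₀ (by linarith)]
        have := W.minBudget_le k
        have := W.budget_pos k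
        unfold threshold
        nlinarith
      have : (N : ℝ) - n ≤ N := by linarith [(Nat.cast_nonneg n : (0 : ℝ) ≤ n)]
      have : 0 ≤ W.threshold / d := by positivity
      have := W.budget_pos k
      exact mul_le_mul h4 ‹_› (by linarith) (by positivity)
    have : 0 < W.budget k * N := mul_pos (W.budget_pos k) hN'
    linarith

end Reassignment

end WCMDP

/-! ### Averages along a drift recursion -/

/-- Telescoping the drift bounds the time average of `u` by `c / ρ` up to `O(1/T)`, without using
convergence of `u`. -/
theorem sum_le_of_drift {u : ℕ → ℝ} {ρ c : ℝ} (hu : ∀ t, 0 ≤ u t)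
    (hdrift : ∀ t, u (t + 1) ≤ (1 - ρ) * u t + c) (T : ℕ) :
    ρ * ∑ t ∈ Finset.range T, u t ≤ u 0 + T * c := by
  have h : ∀ T, ρ * ∑ t ∈ Finset.range T, u t ≤ u 0 - u T + T * c := by
    intro T
    induction T with
    | zero => simp
    | succ T ih =>
      rw [Finset.sum_range_succ]
      push_cast
      linarith [hdrift T]
  linarith [h T, hu T]

theorem le_cesaro_limit_of_drift {u r : ℕ → ℝ} {ρ c c' G L R : ℝ} (hρ : 0 < ρ) (hG : 0 ≤ G)
    (hu : ∀ t, 0 ≤ u t) (hdrift : ∀ t, u (t + 1) ≤ (1 - ρ) * u t + c)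
    (hr : ∀ t, L - G * u t - c' ≤ r t)
    (hR : Tendsto (fun T : ℕ => (1 / (T : ℝ)) * ∑ t ∈ Finset.range T, r t) atTop (𝓝 R)) :
    L - G * c / ρ - c' ≤ R := by
  have hlim : Tendsto (fun T : ℕ => L - G * c / ρ - c' - G * u 0 / ρ * (1 / (T : ℝ))) atTop
      (𝓝 (L - G * c / ρ - c' - G * u 0 / ρ * 0)) :=
    tendsto_const_nhds.sub (tendsto_one_div_atTop_nhds_zero_nat.const_mul _)
  rw [mul_zero, sub_zero] at hlim
  refine le_of_tendsto_of_tendsto hlim hR ?_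
  filter_upwards [eventually_gt_atTop 0] with T hT
  have hT' : (0 : ℝ) < T := by exact_mod_cast hT
  have h1 := sum_le_of_drift hu hdrift T
  have h2 : ∑ t ∈ Finset.range T, u t ≤ (u 0 + T * c) / ρ := by
    rw [le_div_iff₀ hρ, mul_comm]; exact h1
  have h3 : T * (L - c') - G * ∑ t ∈ Finset.range T, u t ≤ ∑ t ∈ Finset.range T, r t := by
    calc T * (L - c') - G * ∑ t ∈ Finset.range T, u t
        = ∑ t ∈ Finset.range T, (L - G * u t - c') := by
          simp only [Finset.sum_sub_distrib, Finset.sum_const, Finset.card_range, nsmul_eq_mul,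
            Finset.mul_sum]
          ring
      _ ≤ _ := Finset.sum_le_sum fun t _ => hr t
  have h4 : G * ∑ t ∈ Finset.range T, u t ≤ G * ((u 0 + T * c) / ρ) :=
    mul_le_mul_of_nonneg_left h2 hG
  calc L - G * c / ρ - c' - G * u 0 / ρ * (1 / (T : ℝ))
      = (1 / (T : ℝ)) * (T * (L - c') - G * ((u 0 + T * c) / ρ)) := by
        field_simp; ring
    _ ≤ _ := mul_le_mul_of_nonneg_left (by linarith) (by positivity)

/-! ### The deficit of a configuration -/

section Deficit

variable {S E : Type*} [NormedAddCommGroup E] {N : ℕ}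

/-- Sum of the features of the arms with ID below `n`. -/
def prefixSum (v : Fin N → S → E) (e : Equiv.Perm (Fin N)) (n : ℕ) (x : Fin N → S) : E :=
  ∑ i with (e i : ℕ) < n, v i (x i)

/-- The smallest `u` such that the sum over each prefix missing at least `u` arms is at most `β`
times the number of missing arms. -/
def deficit (β : ℝ) (v : Fin N → S → E) (e : Equiv.Perm (Fin N)) (x : Fin N → S) : ℕ :=
  sInf {u : ℕ | ∀ n, n + u ≤ N → ‖prefixSum v e n x‖ ≤ β * ((N : ℝ) - n)}

variable {β B γ D : ℝ} {v : Fin N → S → E} {e : Equiv.Perm (Fin N)} {x x' : Fin N → S}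

theorem all_mem_deficit_set (hβ : 0 ≤ β) :
    N ∈ {u : ℕ | ∀ n, n + u ≤ N → ‖prefixSum v e n x‖ ≤ β * ((N : ℝ) - n)} := by
  intro n hn
  obtain rfl : n = 0 := by omega
  simp [prefixSum]
  positivity

theorem deficit_le_card (hβ : 0 ≤ β) : deficit β v e x ≤ N := Nat.sInf_le (all_mem_deficit_set hβ)

theorem norm_prefixSum_le_of_deficit (hβ : 0 ≤ β) {n : ℕ} (hn : n + deficit β v e x ≤ N) :
    ‖prefixSum v e n x‖ ≤ β * ((N : ℝ) - n) :=
  Nat.sInf_mem ⟨N, all_mem_deficit_set hβ⟩ n hn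

/-- The extra `1` pays for rounding the real threshold `r` up to an integer. -/
theorem deficit_le {r : ℝ} (hr : 0 ≤ r)
    (h : ∀ n ≤ N, r ≤ (N : ℝ) - n → ‖prefixSum v e n x‖ ≤ β * ((N : ℝ) - n)) :
    (deficit β v e x : ℝ) ≤ r + 1 := by
  refine le_trans ?_ (Nat.ceil_lt_add_one hr).le
  refine Nat.cast_le.2 (Nat.sInf_le fun n hn => h n (by omega) ?_)
  have h1 := Nat.le_ceil r
  have h2 : (n : ℝ) + ⌈r⌉₊ ≤ N := by exact_mod_cast hn
  linarith

theorem card_filter_perm_le (e : Equiv.Perm (Fin N)) (m n : ℕ) :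
    (Finset.univ.filter fun i : Fin N => m ≤ (e i : ℕ) ∧ (e i : ℕ) < n).card ≤ n - m := by
  rw [← Nat.card_Ico]
  refine Finset.card_le_card_of_injOn (fun i => (e i : ℕ)) (fun i hi => ?_) fun i _ j _ h => ?_
  · simpa using (Finset.mem_filter.1 hi).2
  · exact e.injective (Fin.ext h)

theorem norm_prefixSum_le_add (hv : ∀ i s, ‖v i s‖ ≤ B) {m n : ℕ} (hmn : m ≤ n)
    (hB : 0 ≤ B) : ‖prefixSum v e n x‖ ≤ ‖prefixSum v e m x‖ + B * ((n : ℝ) - m) := by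
  have hsplit : prefixSum v e n x = prefixSum v e m x +
      ∑ i with m ≤ (e i : ℕ) ∧ (e i : ℕ) < n, v i (x i) := by
    unfold prefixSum
    rw [← Finset.sum_union]
    · refine Finset.sum_congr ?_ fun _ _ => rfl
      ext i
      simp only [Finset.mem_filter, Finset.mem_univ, true_and, Finset.mem_union]
      omega
    · rw [Finset.disjoint_filter]
      intro i _ h
      omega
  rw [hsplit]
  refine (norm_add_le _ _).trans (add_le_add le_rfl ?_)
  refine (norm_sum_le_of_le _ fun i _ => hv i (x i)).trans ?_
  rw [Finset.sum_const, nsmul_eq_mul, mul_comm]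
  refine mul_le_mul_of_nonneg_left ?_ hB
  rw [← Nat.cast_sub hmn]
  exact_mod_cast card_filter_perm_le e m n

/-- Contraction leaves the prefix missing `w` arms below its allowance by `(1 - γ) β w - D`. Adding
one more arm raises the norm by at most `B` and lowers the allowance by `β`, so the surplus admits
about `(1 - γ) β w / (B + β)` further arms. -/
theorem deficit_step_le (hβ : 0 < β) (hB : 0 ≤ B) (hγ0 : 0 ≤ γ) (hγ1 : γ < 1) (hD : 0 ≤ D)
    (hv : ∀ i s, ‖v i s‖ ≤ B) {w : ℕ} (hw : deficit β v e x ≤ w) (hwN : w ≤ N)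
    (hstep : ∀ n, n + w ≤ N → ‖prefixSum v e n x'‖ ≤ γ * ‖prefixSum v e n x‖ + D) :
    (deficit β v e x' : ℝ) ≤
      (1 - (1 - γ) * β / (B + β)) * w + D / ((1 - γ) * β) + 1 := by
  have hγ' : 0 < 1 - γ := by linarith
  have hBβ : 0 < B + β := by linarith
  have hρ : (1 - γ) * β / (B + β) ≤ 1 := by
    rw [div_le_one hBβ]; nlinarith
  have hgood : ∀ n, n + w ≤ N → ‖prefixSum v e n x'‖ ≤ γ * (β * ((N : ℝ) - n)) + D :=
    fun n hn => (hstep n hn).trans (by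
      have := norm_prefixSum_le_of_deficit (v := v) (e := e) (x := x) hβ.le
        ((Nat.add_le_add_left hw n).trans hn)
      gcongr)
  have hE : (1 - γ) * β * (D / ((1 - γ) * β)) = D := by field_simp
  have hEnn : 0 ≤ D / ((1 - γ) * β) := by positivity
  set F := D / ((1 - γ) * β) with hF
  set ρ := (1 - γ) * β / (B + β) with hρd
  have hρE : ρ * (B + β) = (1 - γ) * β := by rw [hρd]; field_simp
  have hwnn : (0 : ℝ) ≤ w := Nat.cast_nonneg w
  have hr : 0 ≤ (1 - ρ) * w := mul_nonneg (by linarith) hwnn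
  refine deficit_le (by linarith) fun n hn hq => ?_
  rcases le_or_gt (n + w) N with h | h
  · refine (hgood n h).trans ?_
    have : (1 - γ) * β * F ≤ (1 - γ) * β * ((N : ℝ) - n) :=
      mul_le_mul_of_nonneg_left (by linarith) (by positivity)
    nlinarith
  -- Longer prefixes are compared with the one missing exactly `w` arms, paying `B` for each arm in
  -- between.
  · have h1 := hgood (N - w) (by omega)
    have h2 := norm_prefixSum_le_add (x := x') (e := e) hv (show N - w ≤ n by omega) hB
    rw [Nat.cast_sub hwN] at h1 h2
    have h3 : (B + β) * ((1 - ρ) * w + F) ≤ (B + β) * ((N : ℝ) - n) :=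
      mul_le_mul_of_nonneg_left hq hBβ.le
    have h4 : (B + β) * ((1 - ρ) * w) = (B + β) * w - (1 - γ) * β * w := by
      rw [← hρE]; ring
    have h5 : (1 - γ) * β * F ≤ (B + β) * F :=
      mul_le_mul_of_nonneg_right (by nlinarith) hEnn
    rw [hE] at h5
    nlinarith

end Deficit

namespace WCMDP

variable {S A : Type*} [Fintype S] [Fintype A] {K N : ℕ}

/-! ### Execution of the ideal actions -/

section Execution

variable {W : WCMDP S A K N} {e : Equiv.Perm (Fin N)}

theorem filter_le_eq_filter_lt (e : Equiv.Perm (Fin N)) (m : Fin N) :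
    (Finset.univ.filter fun j => e j ≤ m) =
      Finset.univ.filter fun j => (e j : ℕ) < (m : ℕ) + 1 := by
  ext j
  simp only [Finset.mem_filter, Finset.mem_univ, true_and, Fin.le_def]
  omega

omit [Fintype S] [Fintype A] in
theorem executed_eq_of_forall {s : Fin N → S} {ah : Fin N → A} {i : Fin N}
    (h : ∀ n ≤ (e i : ℕ) + 1, ∀ k, ∑ j with (e j : ℕ) < n, W.cost k j (s j) (ah j) ≤
      W.budget k * N) : W.executed e s ah i = ah i := by
  classical
  unfold executed
  refine if_pos fun m hm k => ?_
  have hm' : (m : ℕ) ≤ e i := hm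
  rw [filter_le_eq_filter_lt]
  exact h (m + 1) (by omega) k

omit [Fintype S] [Fintype A] in
theorem executed_feasible (W : WCMDP S A K N) (e : Equiv.Perm (Fin N)) (s : Fin N → S)
    (ah : Fin N → A) (k : Fin K) :
    ∑ i, W.cost k i (s i) (W.executed e s ah i) ≤ W.budget k * N := by
  classical
  set good : Fin N → Prop := fun i =>
    ∀ m ≤ e i, ∀ k, ∑ j with e j ≤ m, W.cost k j (s j) (ah j) ≤ W.budget k * N with hgood
  have h1 : ∑ i, W.cost k i (s i) (W.executed e s ah i) =
      ∑ i with good i, W.cost k i (s i) (ah i) := by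
    rw [Finset.sum_filter]
    refine Finset.sum_congr rfl fun i _ => ?_
    have : W.executed e s ah i = if good i then ah i else W.zeroAction := by
      unfold executed
      congr
    rw [this]
    split_ifs
    · rfl
    · exact W.cost_zeroAction k i (s i)
  rw [h1]
  rcases (Finset.univ.filter good).eq_empty_or_nonempty with h | h
  · rw [h, Finset.sum_empty]
    exact mul_nonneg (W.budget_pos k).le (Nat.cast_nonneg N)
  -- All arms with a passed test lie in the prefix ending at the last of them, whose own test bounds
  -- the cost of that prefix.
  · obtain ⟨i, hi, hmax⟩ := Finset.exists_max_image _ e h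
    refine le_trans ?_ ((Finset.mem_filter.1 hi).2 (e i) le_rfl k)
    refine Finset.sum_le_sum_of_subset_of_nonneg (fun j hj => ?_)
      fun j _ _ => W.cost_nonneg k j (s j) (ah j)
    simpa using hmax j hj

theorem idPolicy_isFeasible (W : WCMDP S A K N) (y : Fin N → S → A → ℝ)
    (hy : ∀ i s a, 0 ≤ y i s a) (e : Equiv.Perm (Fin N)) (s₀ : Fin N → S) :
    W.IsFeasible (W.idPolicy y hy e) s₀ := by
  intro t p hp k
  simp only [stateActionLaw, PMF.support_bind, Set.mem_iUnion, PMF.support_map, idPolicy,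
    Set.mem_image] at hp
  obtain ⟨hs, -, a, ⟨ah, -, rfl⟩, rfl⟩ := hp
  exact W.executed_feasible e hs.2 ah k

end Execution

end WCMDP

namespace WCMDP

variable {S A : Type*} [Fintype S] [Fintype A] {K N : ℕ}

/-! ### One step of the ID policy -/

/-- Features of the arms that predict, for all future times, the rewards and costs under the
single-armed policies, and which these policies contract by a factor `γ`. -/
structure IsFeature (W : WCMDP S A K N) (y : Fin N → S → A → ℝ) (hy : ∀ i s a, 0 ≤ y i s a)
    (v : Fin N → S → FeatureSpace (Option (Fin K))) (γ B : ℝ) : Prop where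
  reward : ∀ i s, v i s (0, none) =
    (W.singleArmPolicy y hy i s).expect (W.reward i s) - ∑ s, ∑ a, y i s a * W.reward i s a
  cost : ∀ k i s, v i s (0, some k) =
    (W.singleArmPolicy y hy i s).expect (W.cost k i s) - W.meanCost y k i
  contract : ∀ i s, (W.singleArmPolicy y hy i s).expect
    (fun a => (W.trans i s a).expect (v i)) = scaledShift _ γ (v i s)
  bound : ∀ i s, ‖v i s‖ ≤ B

theorem exists_isFeature [DecidableEq S] {W : WCMDP S A K N} {y : Fin N → S → A → ℝ}
    (hy : W.IsLPFeasible y) {M B : ℝ} (hr : ∀ i s a, |W.reward i s a| ≤ M)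
    (hc : ∀ k i s a, W.cost k i s a ≤ M) {τ : ℕ} (hτ : 0 < τ)
    (hmix : ∀ i, mixingTime (W.singleArmMatrix y i) (stateDist y i) ≤ (τ : ℕ∞))
    (hB : 0 ≤ B) (hBM : 64 * (K + 1) * τ * M ^ 2 ≤ B ^ 2) :
    ∃ v, W.IsFeature y hy.nonneg v (mixRate τ) B := by
  have hpol : ∀ i (f : A → ℝ) s, (∀ a, |f a| ≤ M) →
      |(W.singleArmPolicy y hy.nonneg i s).expect f| ≤ M := fun i f s hf => by
    rw [← Real.norm_eq_abs]
    exact PMF.norm_expect_le_of_le _ hf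
  have h := fun i => exists_feature (W.isStochastic_singleArmMatrix hy.nonneg i)
    (stateDist_nonneg hy.nonneg i) (hy.sum_eq_one i) (vecMul_stateDist hy i) hτ (hmix i)
    (g := fun (o : Option (Fin K)) s => o.elim
      ((W.singleArmPolicy y hy.nonneg i s).expect (W.reward i s))
      (fun k => (W.singleArmPolicy y hy.nonneg i s).expect (W.cost k i s))) (M := M)
    (by
      rintro (_ | k) s
      · exact hpol i _ s (hr i s)
      · refine hpol i _ s fun a => ?_
        rw [abs_of_nonneg (W.cost_nonneg k i s a)]
        exact hc k i s a)
  choose v hv using h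
  refine ⟨v, fun i s => ?_, fun k i s => ?_, fun i s => ?_, fun i s => ?_⟩
  · rw [(hv i).1, ← sum_stateDist_mul_expect (W := W) hy.nonneg]
    rfl
  · rw [(hv i).1, meanCost, ← sum_stateDist_mul_expect (W := W) hy.nonneg]
    rfl
  · rw [expect_expect_trans]
    exact (hv i).2.1 s
  · refine le_of_sq_le_sq (((hv i).2.2 s).trans (le_trans (le_of_eq ?_) hBM)) hB
    simp [Fintype.card_option]

section OneStep

variable {W : WCMDP S A K N} {y : Fin N → S → A → ℝ} {hy : ∀ i s a, 0 ≤ y i s a}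
  {v : Fin N → S → FeatureSpace (Option (Fin K))} {β γ B M c : ℝ} {e : Equiv.Perm (Fin N)}

/-- All arms except for about `max (deficit) Q` many execute their ideal actions, where the
fluctuation term `Q` is of order `√N`. -/
theorem exists_fluctuation_bound (hv : W.IsFeature y hy v γ B) (hβ : 0 < β) (hM : 0 ≤ M)
    (hc : 0 ≤ c) (hcost : ∀ k i s a, W.cost k i s a ≤ M)
    (hslack : ∀ k, ∀ n ≤ N, ∑ i with (e i : ℕ) < n, W.meanCost y k i ≤
      W.budget k * N - (2 * β * ((N : ℝ) - n) - c)) (s : Fin N → S) :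
    ∃ Q : (Fin N → A) → ℝ, (∀ ah, 0 ≤ Q ah) ∧
      (prodPMF fun i => W.singleArmPolicy y hy i (s i)).expect Q ≤ (2 * K * M * √N + c) / β ∧
      ∀ ah (w : ℕ), deficit β v e s ≤ w → Q ah ≤ w →
        ∀ i, (e i : ℕ) + 1 + w ≤ N → W.executed e s ah i = ah i := by
  have hmax := fun k : Fin K => exists_maximal_bound e
    (fun i => W.singleArmPolicy y hy i (s i))
    (fun i a => W.cost k i (s i) a - (W.singleArmPolicy y hy i (s i)).expect (W.cost k i (s i)))
    hM (fun i => by rw [PMF.expect_sub, PMF.expect_const, sub_self]) (fun i a => by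
      have h1 := W.cost_nonneg k i (s i)
      have h2 := (W.singleArmPolicy y hy i (s i)).expect_nonneg h1
      have h3 := (W.singleArmPolicy y hy i (s i)).expect_le_of_le (hcost k i (s i))
      have h4 := h1 a
      have h5 := hcost k i (s i) a
      rw [Real.norm_eq_abs, abs_le]
      constructor <;> linarith)
  choose D hD0 hD hDE using hmax
  -- The realized cost of a prefix is its mean cost, plus the state deviation, at most `β (N - n)`
  -- on good prefixes, plus sampling noise. Against the slack `2β (N - n) - c` the budget holds once
  -- noise plus `c` is at most `β (N - n)`. Summing the maxima over `k` serves all constraints at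
  -- once.
  refine ⟨fun ah => (∑ k, D k ah + c) / β, fun ah => ?_, ?_, fun ah w hw hQ i hi => ?_⟩
  · have := Finset.sum_nonneg fun k (_ : k ∈ Finset.univ) => hD0 k ah
    positivity
  · simp only [div_eq_inv_mul]
    rw [PMF.expect_const_mul, PMF.expect_add, PMF.expect_const, PMF.expect_sum]
    refine mul_le_mul_of_nonneg_left (add_le_add ?_ le_rfl) (by positivity)
    refine (Finset.sum_le_sum fun k _ => hDE k).trans_eq ?_
    simp
    ring
  · refine executed_eq_of_forall fun n hn k => ?_
    have hnN : n + w ≤ N := by omega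
    have hnw : (n : ℝ) + w ≤ N := by exact_mod_cast hnN
    have h1 : ∑ j with (e j : ℕ) < n, (W.cost k j (s j) (ah j) -
        (W.singleArmPolicy y hy j (s j)).expect (W.cost k j (s j))) ≤ ∑ k, D k ah :=
      (le_abs_self _).trans ((hD k ah n (by omega)).trans
        (Finset.single_le_sum (fun k _ => hD0 k ah) (Finset.mem_univ k)))
    have h2 : ∑ j with (e j : ℕ) < n, ((W.singleArmPolicy y hy j (s j)).expect
        (W.cost k j (s j)) - W.meanCost y k j) ≤ β * ((N : ℝ) - n) := by
      have h3 := norm_prefixSum_le_of_deficit (v := v) (e := e) (x := s) hβ.le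
        ((Nat.add_le_add_left hw n).trans hnN)
      refine le_trans ?_ ((lp.norm_apply_le_norm (by norm_num) (prefixSum v e n s)
        (0, some k)).trans h3)
      refine le_trans (le_of_eq ?_) (le_abs_self _)
      rw [prefixSum, lp.coeFn_sum, Finset.sum_apply]
      simp only [hv.cost]
    have h4 := hslack k n (by omega)
    have h5 : ∑ k, D k ah + c ≤ β * ((N : ℝ) - n) := by
      rw [div_le_iff₀ hβ, mul_comm] at hQ
      refine hQ.trans (mul_le_mul_of_nonneg_left (by linarith) hβ.le)
    rw [Finset.sum_sub_distrib] at h1 h2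
    linarith

/-- There are two layers of independent noise: the ideal actions given the state, and the
transitions given the executed actions. Each has vectors of norm at most `2B`, so the maximal
inequality gives `4B√N` twice. -/
theorem expect_deficit_le (hv : W.IsFeature y hy v γ B) (hβ : 0 < β) (hM : 0 ≤ M)
    (hc : 0 ≤ c) (hB : 0 ≤ B) (hγ0 : 0 ≤ γ) (hγ1 : γ < 1)
    (hcost : ∀ k i s a, W.cost k i s a ≤ M)
    (hslack : ∀ k, ∀ n ≤ N, ∑ i with (e i : ℕ) < n, W.meanCost y k i ≤
      W.budget k * N - (2 * β * ((N : ℝ) - n) - c)) (s : Fin N → S) :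
    (prodPMF fun i => W.singleArmPolicy y hy i (s i)).expect (fun ah =>
      (W.sysTrans s (W.executed e s ah)).expect fun s' => (deficit β v e s' : ℝ)) ≤
      (1 - (1 - γ) * β / (B + β)) * deficit β v e s +
        ((2 * K * M * √N + c) / β + 8 * B * √N / ((1 - γ) * β) + 2) := by
  have hγ' : 0 < 1 - γ := by linarith
  have hBβ : 0 < B + β := by linarith
  have hρ0 : 0 ≤ (1 - γ) * β / (B + β) := by positivity
  have hρ1 : (1 - γ) * β / (B + β) ≤ 1 := by
    rw [div_le_one hBβ]; nlinarith
  obtain ⟨Q, hQ0, hQE, hexec⟩ := exists_fluctuation_bound hv hβ hM hc hcost hslack s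
  have hcond : ∀ i a, ‖(W.trans i (s i) a).expect (v i)‖ ≤ B := fun i a =>
    PMF.norm_expect_le_of_le _ (hv.bound i)
  obtain ⟨D₂, hD₂0, hD₂, hD₂E⟩ := exists_maximal_bound e
    (fun i => W.singleArmPolicy y hy i (s i))
    (fun i a => (W.trans i (s i) a).expect (v i) - scaledShift _ γ (v i (s i)))
    (b := 2 * B) (by positivity)
    (fun i => by rw [PMF.expect_sub, PMF.expect_const, hv.contract, sub_self])
    (fun i a => by
      have h1 := norm_scaledShift_le hγ0 (v i (s i))
      have h2 : γ * ‖v i (s i)‖ ≤ 1 * B :=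
        mul_le_mul hγ1.le (hv.bound i (s i)) (norm_nonneg _) zero_le_one
      linarith [norm_sub_le ((W.trans i (s i) a).expect (v i)) (scaledShift _ γ (v i (s i))),
        hcond i a])
  have hmax₁ := fun ah : Fin N → A => exists_maximal_bound e
    (fun i => W.trans i (s i) (W.executed e s ah i))
    (fun i s' => v i s' - (W.trans i (s i) (W.executed e s ah i)).expect (v i))
    (b := 2 * B) (by positivity)
    (fun i => by rw [PMF.expect_sub, PMF.expect_const, sub_self])
    (fun i s' => by
      linarith [norm_sub_le (v i s') ((W.trans i (s i) (W.executed e s ah i)).expect (v i)),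
        hcond i (W.executed e s ah i), hv.bound i s'])
  choose D₁ hD₁0 hD₁ hD₁E using hmax₁
  have hpt : ∀ ah s', (deficit β v e s' : ℝ) ≤
      ((1 - (1 - γ) * β / (B + β)) * deficit β v e s + 2) + Q ah +
        ((1 - γ) * β)⁻¹ * (D₁ ah s' + D₂ ah) := by
    intro ah s'
    have hF : 0 ≤ ((1 - γ) * β)⁻¹ * (D₁ ah s' + D₂ ah) := by
      have := hD₁0 ah s'
      have := hD₂0 ah
      positivity
    have hu0 : 0 ≤ (1 - (1 - γ) * β / (B + β)) * deficit β v e s :=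
      mul_nonneg (by linarith) (Nat.cast_nonneg _)
    have hceil : (⌈Q ah⌉₊ : ℝ) ≤ Q ah + 1 := (Nat.ceil_lt_add_one (hQ0 ah)).le
    rcases le_or_gt ⌈Q ah⌉₊ N with hle | hgt
    · set w := max (deficit β v e s) ⌈Q ah⌉₊ with hw
      have hwN : w ≤ N := max_le (deficit_le_card hβ.le) hle
      have hstep : ∀ n, n + w ≤ N →
          ‖prefixSum v e n s'‖ ≤ γ * ‖prefixSum v e n s‖ + (D₁ ah s' + D₂ ah) := by
        intro n hn
        -- Transition noise is centered using executed actions and action noise is stated for ideal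
        -- ones; the conditional means cancel because the two agree on this prefix.
        have hdecomp : prefixSum v e n s' = scaledShift _ γ (prefixSum v e n s) +
            (∑ i with (e i : ℕ) < n,
              (v i (s' i) - (W.trans i (s i) (W.executed e s ah i)).expect (v i)) +
            ∑ i with (e i : ℕ) < n,
              ((W.trans i (s i) (ah i)).expect (v i) - scaledShift _ γ (v i (s i)))) := by
          unfold prefixSum
          rw [map_sum, ← Finset.sum_add_distrib, ← Finset.sum_add_distrib]
          refine Finset.sum_congr rfl fun i hi => ?_
          have hin := (Finset.mem_filter.1 hi).2
          rw [hexec ah w (le_max_left _ _) ((Nat.le_ceil _).trans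
            (Nat.cast_le.2 (le_max_right _ _))) i (by omega)]
          abel
        rw [hdecomp]
        refine (norm_add_le _ _).trans (add_le_add (norm_scaledShift_le hγ0 _) ?_)
        exact (norm_add_le _ _).trans (add_le_add (hD₁ ah s' n (by omega))
          (hD₂ ah n (by omega)))
      have h1 := deficit_step_le (w := w) hβ hB hγ0 hγ1 (add_nonneg (hD₁0 ah s') (hD₂0 ah)) hv.bound
        (le_max_left _ _) hwN hstep
      have h2 : (w : ℝ) ≤ deficit β v e s + ⌈Q ah⌉₊ := by
        exact_mod_cast max_le (Nat.le_add_right _ _) (Nat.le_add_left _ _)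
      have h3 : (1 - (1 - γ) * β / (B + β)) * w ≤
          (1 - (1 - γ) * β / (B + β)) * deficit β v e s + ⌈Q ah⌉₊ := by
        refine (mul_le_mul_of_nonneg_left h2 (by linarith)).trans ?_
        rw [mul_add]
        have : (1 - (1 - γ) * β / (B + β)) * (⌈Q ah⌉₊ : ℝ) ≤ ⌈Q ah⌉₊ :=
          mul_le_of_le_one_left (Nat.cast_nonneg _) (by linarith)
        linarith
      rw [div_eq_inv_mul (D₁ ah s' + D₂ ah)] at h1
      linarith
    -- If the fluctuation exceeds the number of arms, the trivial bound `deficit ≤ N` suffices.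
    · have h1 : (deficit β v e s' : ℝ) ≤ ⌈Q ah⌉₊ := by
        exact_mod_cast (deficit_le_card hβ.le).trans hgt.le
      linarith
  have hin : ∀ ah, ((W.sysTrans s (W.executed e s ah)).expect
      fun s' => (deficit β v e s' : ℝ)) ≤
      ((1 - (1 - γ) * β / (B + β)) * deficit β v e s + 2) + Q ah +
        ((1 - γ) * β)⁻¹ * (4 * B * √N + D₂ ah) := by
    intro ah
    refine (PMF.expect_mono _ (hpt ah)).trans ?_
    rw [PMF.expect_add, PMF.expect_const, PMF.expect_const_mul, PMF.expect_add, PMF.expect_const]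
    have := hD₁E ah
    refine add_le_add le_rfl (mul_le_mul_of_nonneg_left (add_le_add ?_ le_rfl) (by positivity))
    refine le_trans this (le_of_eq ?_)
    ring
  refine (PMF.expect_mono _ hin).trans ?_
  rw [PMF.expect_add, PMF.expect_add, PMF.expect_const, PMF.expect_const_mul, PMF.expect_add,
    PMF.expect_const]
  have h1 : ((1 - γ) * β)⁻¹ * (4 * B * √N +
      (prodPMF fun i => W.singleArmPolicy y hy i (s i)).expect D₂) ≤
      ((1 - γ) * β)⁻¹ * (8 * B * √N) :=
    mul_le_mul_of_nonneg_left (by linarith) (by positivity)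
  rw [div_eq_inv_mul (8 * B * √(N : ℝ))]
  linarith

/-- Arms that may miss their ideal action cost at most `2M` each. The ideal reward differs from its
LP value by one coordinate of the total feature sum, and that sum is bounded through the longest
good prefix. -/
theorem le_expect_reward (hv : W.IsFeature y hy v γ B) (hβ : 0 < β) (hM : 0 ≤ M)
    (hc : 0 ≤ c) (hB : 0 ≤ B) (hr : ∀ i s a, |W.reward i s a| ≤ M)
    (hcost : ∀ k i s a, W.cost k i s a ≤ M)
    (hslack : ∀ k, ∀ n ≤ N, ∑ i with (e i : ℕ) < n, W.meanCost y k i ≤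
      W.budget k * N - (2 * β * ((N : ℝ) - n) - c)) (s : Fin N → S) :
    ∑ i, ∑ s, ∑ a, y i s a * W.reward i s a - (β + B + 2 * M) * deficit β v e s -
        2 * M * ((2 * K * M * √N + c) / β + 1) ≤
      (prodPMF fun i => W.singleArmPolicy y hy i (s i)).expect (fun ah =>
        ∑ i, W.reward i (s i) (W.executed e s ah i)) := by
  classical
  obtain ⟨Q, hQ0, hQE, hexec⟩ := exists_fluctuation_bound hv hβ hM hc hcost hslack s
  have hpt : ∀ ah, ∑ i, W.reward i (s i) (ah i) - 2 * M * (deficit β v e s + 1) -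
      2 * M * Q ah ≤ ∑ i, W.reward i (s i) (W.executed e s ah i) := by
    intro ah
    set w := max (deficit β v e s) ⌈Q ah⌉₊ with hw
    have h1 : ∀ i, W.reward i (s i) (ah i) -
        (if N - w ≤ (e i : ℕ) ∧ (e i : ℕ) < N then 2 * M else 0) ≤
        W.reward i (s i) (W.executed e s ah i) := by
      intro i
      split_ifs with h
      · have := abs_le.1 (hr i (s i) (ah i))
        have := abs_le.1 (hr i (s i) (W.executed e s ah i))
        linarith
      · have hi := (e i).2
        rw [hexec ah w (le_max_left _ _) ((Nat.le_ceil _).trans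
          (Nat.cast_le.2 (le_max_right _ _))) i (by omega), sub_zero]
    have h2 := Finset.sum_le_sum fun i (_ : i ∈ Finset.univ) => h1 i
    rw [Finset.sum_sub_distrib, ← Finset.sum_filter, Finset.sum_const, nsmul_eq_mul] at h2
    have h3 : ((Finset.univ.filter fun i : Fin N => N - w ≤ (e i : ℕ) ∧ (e i : ℕ) < N).card : ℝ) ≤
        deficit β v e s + 1 + Q ah := by
      have h4 : ((Finset.univ.filter fun i : Fin N =>
          N - w ≤ (e i : ℕ) ∧ (e i : ℕ) < N).card : ℝ) ≤ deficit β v e s + ⌈Q ah⌉₊ := by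
        have := card_filter_perm_le e (N - w) N
        have hw' : w ≤ deficit β v e s + ⌈Q ah⌉₊ :=
          max_le (Nat.le_add_right _ _) (Nat.le_add_left _ _)
        exact_mod_cast this.trans (by omega)
      linarith [(Nat.ceil_lt_add_one (hQ0 ah)).le]
    have h5 := mul_le_mul_of_nonneg_right h3 (by positivity : 0 ≤ 2 * M)
    linarith
  refine le_trans ?_ (PMF.expect_mono _ hpt)
  rw [PMF.expect_sub, PMF.expect_sub, PMF.expect_const, PMF.expect_const_mul, PMF.expect_sum]
  have hrw : ∀ i, ((prodPMF fun i => W.singleArmPolicy y hy i (s i)).expect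
      fun ah => W.reward i (s i) (ah i)) =
      (W.singleArmPolicy y hy i (s i)).expect (W.reward i (s i)) := fun i =>
    prodPMF_expect_eval _ i _
  simp only [hrw]
  set u := deficit β v e s with hu
  have h1 : ∑ i, ∑ s, ∑ a, y i s a * W.reward i s a -
      ∑ i, (W.singleArmPolicy y hy i (s i)).expect (W.reward i (s i)) ≤ (β + B) * u := by
    have huN : u ≤ N := deficit_le_card hβ.le
    have h2 : ‖prefixSum v e N s‖ ≤ (β + B) * u := by
      have h3 := norm_prefixSum_le_add (x := s) (e := e) hv.bound (Nat.sub_le N u) hB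
      have h4 := norm_prefixSum_le_of_deficit (v := v) (e := e) (x := s) hβ.le
        (n := N - u) (by omega)
      rw [Nat.cast_sub huN] at h3 h4
      linarith
    refine le_trans ?_ ((lp.norm_apply_le_norm (by norm_num) (prefixSum v e N s)
      (0, none)).trans h2)
    refine le_trans (le_of_eq ?_) (neg_abs_le _ |> neg_le_neg |>.trans_eq (neg_neg _))
    rw [prefixSum, lp.coeFn_sum, Finset.sum_apply]
    simp only [hv.reward]
    rw [Finset.filter_true_of_mem fun i _ => (e i).2, Finset.sum_sub_distrib]
    ring
  have h2 := mul_le_mul_of_nonneg_left hQE (by positivity : 0 ≤ 2 * M)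
  linarith

end OneStep

end WCMDP

namespace WCMDP

variable {S A : Type*} [Fintype S] [Fintype A] {K N : ℕ}

/-! ### The Markov chain of the ID policy -/

section IDChain

/-- Transition kernel of the system under the ID policy. -/
def idChain (W : WCMDP S A K N) (y : Fin N → S → A → ℝ) (hy : ∀ i s a, 0 ≤ y i s a)
    (e : Equiv.Perm (Fin N)) (s : Fin N → S) : PMF (Fin N → S) :=
  (prodPMF fun i => W.singleArmPolicy y hy i (s i)).bind fun ah =>
    W.sysTrans s (W.executed e s ah)

theorem stateLaw_idPolicy_succ (W : WCMDP S A K N) (y : Fin N → S → A → ℝ)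
    (hy : ∀ i s a, 0 ≤ y i s a) (e : Equiv.Perm (Fin N)) (s₀ : Fin N → S) (t : ℕ) :
    W.stateLaw (W.idPolicy y hy e) s₀ (t + 1) =
      (W.stateLaw (W.idPolicy y hy e) s₀ t).bind (W.idChain y hy e) := by
  rw [stateLaw_succ]
  unfold idPolicy
  rw [stateActionLaw_const, PMF.bind_bind]
  congr 1
  funext s
  rw [PMF.bind_map, PMF.bind_map]
  rfl

theorem expectedReward_idPolicy (W : WCMDP S A K N) (y : Fin N → S → A → ℝ)
    (hy : ∀ i s a, 0 ≤ y i s a) (e : Equiv.Perm (Fin N)) (s₀ : Fin N → S) (t : ℕ) :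
    W.expectedReward (W.idPolicy y hy e) s₀ t =
      (W.stateLaw (W.idPolicy y hy e) s₀ t).expect fun s =>
        (prodPMF fun i => W.singleArmPolicy y hy i (s i)).expect fun ah =>
          ∑ i, W.reward i (s i) (W.executed e s ah i) := by
  rw [expectedReward_eq]
  unfold idPolicy
  rw [stateActionLaw_const, PMF.expect_bind]
  congr 1
  funext s
  rw [PMF.expect_map, PMF.expect_map]

theorem exists_tendsto_avgReward_idPolicy (W : WCMDP S A K N) (y : Fin N → S → A → ℝ)
    (hy : ∀ i s a, 0 ≤ y i s a) (e : Equiv.Perm (Fin N)) (s₀ : Fin N → S) :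
    ∃ R, Tendsto (fun T => W.avgReward (W.idPolicy y hy e) s₀ T) atTop (𝓝 R) := by
  obtain ⟨R, hR⟩ := exists_tendsto_cesaro_expect (W.idChain y hy e)
    (W.stateLaw (W.idPolicy y hy e) s₀) (W.stateLaw_idPolicy_succ y hy e s₀)
    fun s => (1 / (N : ℝ)) * (prodPMF fun i => W.singleArmPolicy y hy i (s i)).expect fun ah =>
          ∑ i, W.reward i (s i) (W.executed e s ah i)
  refine ⟨R, hR.congr fun T => ?_⟩
  simp only [avgReward, PMF.expect_const_mul, ← expectedReward_idPolicy]

theorem card_mul_lpValue (W : WCMDP S A K N) (y : Fin N → S → A → ℝ) (hN : 0 < N) :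
    ∑ i, ∑ s, ∑ a, y i s a * W.reward i s a = N * W.lpValue y := by
  have : (N : ℝ) ≠ 0 := by positivity
  rw [lpValue, ← mul_assoc, mul_one_div_cancel this, one_mul]

variable {W : WCMDP S A K N} {y : Fin N → S → A → ℝ} {hy : ∀ i s a, 0 ≤ y i s a}
  {v : Fin N → S → FeatureSpace (Option (Fin K))} {β γ B M c R : ℝ} {e : Equiv.Perm (Fin N)}
  {s₀ : Fin N → S}

/-- If the budgets can never be exceeded, the ID policy attains the LP value. -/
theorem lpValue_le_of_not_binding (hv : W.IsFeature y hy v γ B) (hγ0 : 0 ≤ γ) (hγ1 : γ < 1)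
    (hN : 0 < N) (hcost : ∀ k k' i s a, W.cost k i s a ≤ W.budget k')
    (hR : Tendsto (fun T => W.avgReward (W.idPolicy y hy e) s₀ T) atTop (𝓝 R)) :
    W.lpValue y ≤ R := by
  have hN' : (0 : ℝ) < N := by exact_mod_cast hN
  have hexec : ∀ s ah, W.executed e s ah = ah := by
    intro s ah
    funext i
    refine executed_eq_of_forall fun n _ k => ?_
    calc ∑ j with (e j : ℕ) < n, W.cost k j (s j) (ah j)
        ≤ ∑ j, W.cost k j (s j) (ah j) :=
          Finset.sum_le_sum_of_subset_of_nonneg (Finset.filter_subset _ _)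
            fun j _ _ => W.cost_nonneg k j (s j) (ah j)
      _ ≤ ∑ _j : Fin N, W.budget k := Finset.sum_le_sum fun j _ => hcost k k j (s j) (ah j)
      _ = W.budget k * N := by simp [mul_comm]
  set L := W.stateLaw (W.idPolicy y hy e) s₀ with hL
  set f : (Fin N → S) → FeatureSpace (Option (Fin K)) := fun s => ∑ i, v i (s i) with hf
  -- With every ideal action executed, the expected feature sum evolves exactly by the scaled shift;
  -- no noise term arises because the norm is taken after the expectation.
  have hdrift : ∀ t, ‖(L (t + 1)).expect f‖ ≤ (1 - (1 - γ)) * ‖(L t).expect f‖ + 0 := by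
    intro t
    have h1 : (L (t + 1)).expect f = scaledShift _ γ ((L t).expect f) := by
      rw [hL, stateLaw_idPolicy_succ, PMF.expect_bind, PMF.map_expect]
      congr 1
      funext s
      rw [idChain, PMF.expect_bind]
      simp only [hexec, hf, PMF.expect_sum, map_sum]
      refine Finset.sum_congr rfl fun i _ => ?_
      have h2 : ∀ ah, ((W.sysTrans s ah).expect fun s' => v i (s' i)) =
          (W.trans i (s i) (ah i)).expect (v i) := fun ah => W.expect_sysTrans_eval s ah i _
      simp only [h2]
      rw [prodPMF_expect_eval _ i fun a => (W.trans i (s i) a).expect (v i), hv.contract]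
    rw [h1, sub_sub_cancel, add_zero]
    exact norm_scaledShift_le hγ0 _
  have hr : ∀ t, W.lpValue y - (1 / (N : ℝ)) * ‖(L t).expect f‖ - 0 ≤
      (1 / (N : ℝ)) * W.expectedReward (W.idPolicy y hy e) s₀ t := by
    intro t
    have h1 : W.expectedReward (W.idPolicy y hy e) s₀ t =
        N * W.lpValue y + (L t).expect f (0, none) := by
      have h2 := PMF.map_expect (L t) (lp.evalCLM ℝ (fun _ : ℕ × Option (Fin K) => ℝ) 2
        (0, none)).toLinearMap f
      have h3 : (L t).expect f (0, none) = (L t).expect fun s => f s (0, none) := h2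
      rw [h3, expectedReward_idPolicy, ← (L t).expect_const (N * W.lpValue y), ← PMF.expect_add]
      congr 1
      funext s
      simp only [hexec, hf, PMF.expect_sum]
      rw [lp.coeFn_sum, Finset.sum_apply, ← card_mul_lpValue W y hN, ← Finset.sum_add_distrib]
      refine Finset.sum_congr rfl fun i _ => ?_
      rw [hv.reward, prodPMF_expect_eval _ i fun a => W.reward i (s i) a]
      ring
    have h2 := (abs_le.1 (lp.norm_apply_le_norm (by norm_num) ((L t).expect f) (0, none))).1
    rw [h1, sub_zero, mul_add, ← mul_assoc, one_div_mul_cancel hN'.ne', one_mul, sub_eq_add_neg,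
      ← mul_neg]
    exact add_le_add le_rfl (mul_le_mul_of_nonneg_left h2 (by positivity))
  have := le_cesaro_limit_of_drift (by linarith : 0 < 1 - γ) (by positivity : 0 ≤ 1 / (N : ℝ))
    (fun t => norm_nonneg _) hdrift hr hR
  simpa using this

theorem lpValue_sub_le (hv : W.IsFeature y hy v γ B) (hβ : 0 < β) (hM : 0 ≤ M)
    (hc : 0 ≤ c) (hB : 0 ≤ B) (hγ0 : 0 ≤ γ) (hγ1 : γ < 1) (hN : 0 < N)
    (hr : ∀ i s a, |W.reward i s a| ≤ M) (hcost : ∀ k i s a, W.cost k i s a ≤ M)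
    (hslack : ∀ k, ∀ n ≤ N, ∑ i with (e i : ℕ) < n, W.meanCost y k i ≤
      W.budget k * N - (2 * β * ((N : ℝ) - n) - c))
    (hR : Tendsto (fun T => W.avgReward (W.idPolicy y hy e) s₀ T) atTop (𝓝 R)) :
    W.lpValue y - R ≤ (1 / (N : ℝ)) * ((β + B + 2 * M) *
      ((2 * K * M * √N + c) / β + 8 * B * √N / ((1 - γ) * β) + 2) / ((1 - γ) * β / (B + β)) +
      2 * M * ((2 * K * M * √N + c) / β + 1)) := by
  have hN' : (0 : ℝ) < N := by exact_mod_cast hN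
  have hγ' : 0 < 1 - γ := by linarith
  set L := W.stateLaw (W.idPolicy y hy e) s₀ with hL
  have hdrift : ∀ t, (L (t + 1)).expect (fun s => (deficit β v e s : ℝ)) ≤
      (1 - (1 - γ) * β / (B + β)) * (L t).expect (fun s => (deficit β v e s : ℝ)) +
        ((2 * K * M * √N + c) / β + 8 * B * √N / ((1 - γ) * β) + 2) := by
    intro t
    rw [hL, stateLaw_idPolicy_succ, PMF.expect_bind, ← PMF.expect_const_mul]
    rw [← (W.stateLaw (W.idPolicy y hy e) s₀ t).expect_const
      ((2 * K * M * √N + c) / β + 8 * B * √N / ((1 - γ) * β) + 2), ← PMF.expect_add]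
    refine PMF.expect_mono _ fun s => ?_
    rw [idChain, PMF.expect_bind]
    exact expect_deficit_le hv hβ hM hc hB hγ0 hγ1 hcost hslack s
  have hrew : ∀ t, W.lpValue y - (1 / (N : ℝ)) * (β + B + 2 * M) *
      (L t).expect (fun s => (deficit β v e s : ℝ)) -
        (1 / (N : ℝ)) * (2 * M * ((2 * K * M * √N + c) / β + 1)) ≤
      (1 / (N : ℝ)) * W.expectedReward (W.idPolicy y hy e) s₀ t := by
    intro t
    have h1 : N * W.lpValue y - (β + B + 2 * M) *
        (L t).expect (fun s => (deficit β v e s : ℝ)) -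
        2 * M * ((2 * K * M * √N + c) / β + 1) ≤
        W.expectedReward (W.idPolicy y hy e) s₀ t := by
      rw [expectedReward_idPolicy, ← card_mul_lpValue W y hN]
      refine le_trans (le_of_eq ?_)
        (PMF.expect_mono _ fun s => le_expect_reward hv hβ hM hc hB hr hcost hslack s)
      rw [PMF.expect_sub, PMF.expect_sub, PMF.expect_const, PMF.expect_const,
        PMF.expect_const_mul]
    have h2 := mul_le_mul_of_nonneg_left h1 (by positivity : 0 ≤ 1 / (N : ℝ))
    refine le_trans (le_of_eq ?_) h2
    field_simp
  have := le_cesaro_limit_of_drift (by positivity : 0 < (1 - γ) * β / (B + β))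
    (by positivity : 0 ≤ (1 / (N : ℝ)) * (β + B + 2 * M))
    (fun t => PMF.expect_nonneg _ fun s => Nat.cast_nonneg _) hdrift hrew hR
  rw [mul_add, ← mul_div_assoc, ← mul_assoc (1 / (N : ℝ))]
  linarith

end IDChain

end WCMDP

/-! ### Explicit constants and assembly of the final bound -/

/-- Here `q` stands for `√N`, `h` for `√(Kτ)` and `a` for the smallest budget. In terms of `x = M /
a ≥ 1` one has `1 / β = 32 K x² / M`, and the dominant term is the deficit weight times the noise
divided by the drift rate. -/
theorem drift_constant_le {K τ q h M a : ℝ} (hK : 1 ≤ K) (hτ : 1 ≤ τ) (hq : 1 ≤ q)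
    (hh : 1 ≤ h) (hsq : h * h = K * τ) (ha : 0 < a) (haM : a ≤ M) {β B : ℝ}
    (hβ : β = a ^ 2 / (32 * M * K)) (hB : B = 12 * h * M) :
    (β + B + 2 * M) * ((2 * K * M * q + a / 2) / β + 8 * B * q / (1 / (4 * τ) * β) + 2) /
        (1 / (4 * τ) * β / (B + β)) + 2 * M * ((2 * K * M * q + a / 2) / β + 1) ≤
      10 ^ 9 * (K ^ 5 * M ^ 7 * τ ^ 4 / a ^ 6) * q := by
  have hM : 0 < M := ha.trans_le haM
  obtain ⟨x, hx⟩ : ∃ x, x = M / a := ⟨_, rfl⟩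
  have hx1 : 1 ≤ x := by rw [hx, le_div_iff₀ ha]; linarith
  have hK0 : 0 < K := by linarith
  have hτ0 : 0 < τ := by linarith
  have hq0 : 0 < q := by linarith
  have hh0 : 0 < h := by linarith
  have hx0 : 0 < x := by linarith
  have hβ0 : 0 < β := by rw [hβ]; positivity
  have hβinv : 1 / β = 32 * K * x ^ 2 / M := by rw [hβ, hx]; field_simp
  have hβM : β ≤ M := by
    rw [hβ, div_le_iff₀ (by positivity)]
    nlinarith [mul_le_mul haM haM ha.le hM.le, mul_pos hM hM]
  have hB0 : 0 < B := by rw [hB]; positivity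
  have hKτ : h ≤ K * τ := by nlinarith
  have e1 : (2 * K * M * q + a / 2) / β ≤ 80 * K ^ 2 * x ^ 2 * q := by
    have h1 : a / 2 ≤ K * M * q / 2 := by
      have : M ≤ K * M * q := by
        have : 1 ≤ K * q := by nlinarith
        nlinarith
      linarith
    calc (2 * K * M * q + a / 2) / β = (2 * K * M * q + a / 2) * (1 / β) := by ring
      _ ≤ (5 / 2 * (K * M * q)) * (1 / β) := by
          refine mul_le_mul_of_nonneg_right (by linarith) (by positivity)
      _ = 80 * K ^ 2 * x ^ 2 * q := by rw [hβinv]; field_simp; ring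
  have e2 : 8 * B * q / (1 / (4 * τ) * β) = 12288 * τ * K * x ^ 2 * h * q := by
    calc 8 * B * q / (1 / (4 * τ) * β) = 32 * τ * B * q * (1 / β) := by field_simp; ring
      _ = _ := by rw [hβinv, hB]; field_simp; ring
  have hKK : 1 ≤ K ^ 2 := by nlinarith
  have hxx : 1 ≤ x ^ 2 := by nlinarith
  have hKxq : 1 ≤ K ^ 2 * x ^ 2 * q :=
    one_le_mul_of_one_le_of_one_le (one_le_mul_of_one_le_of_one_le hKK hxx) hq
  have hτh : 1 ≤ τ * h := one_le_mul_of_one_le_of_one_le hτ hh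
  have e3 : (2 * K * M * q + a / 2) / β + 8 * B * q / (1 / (4 * τ) * β) + 2 ≤
      12370 * (q * x ^ 2 * K ^ 2 * τ * h) := by
    rw [e2]
    have h1 : K ^ 2 * x ^ 2 * q * 1 ≤ K ^ 2 * x ^ 2 * q * (τ * h) :=
      mul_le_mul_of_nonneg_left hτh (by positivity)
    have h2 : (τ * K * x ^ 2 * h * q) * 1 ≤ (τ * K * x ^ 2 * h * q) * K :=
      mul_le_mul_of_nonneg_left hK (by positivity)
    linarith
  have e4 : 1 / (1 / (4 * τ) * β / (B + β)) ≤ 1664 * (τ * h * K * x ^ 2) := by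
    calc 1 / (1 / (4 * τ) * β / (B + β)) = 4 * τ * (B + β) * (1 / β) := by field_simp
      _ ≤ 4 * τ * (13 * h * M) * (1 / β) := by
          refine mul_le_mul_of_nonneg_right (mul_le_mul_of_nonneg_left ?_ (by positivity))
            (by positivity)
          rw [hB]
          nlinarith
      _ = _ := by rw [hβinv]; field_simp; ring
  have e5 : β + B + 2 * M ≤ 15 * (h * M) := by rw [hB]; nlinarith
  have hxx4 : x ^ 2 * x ^ 2 ≤ x ^ 6 := by
    calc x ^ 2 * x ^ 2 = x ^ 4 := by ring
      _ ≤ x ^ 6 := pow_le_pow_right₀ hx1 (by norm_num)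
  -- Half a power of `Kτ` is given away to reach integer exponents.
  have hh3 : h * h * h ≤ K ^ 2 * τ ^ 2 := by
    calc h * h * h ≤ K * τ * (K * τ) := by
          rw [hsq]; exact mul_le_mul_of_nonneg_left hKτ (by positivity)
      _ = _ := by ring
  have main1 : (β + B + 2 * M) *
      ((2 * K * M * q + a / 2) / β + 8 * B * q / (1 / (4 * τ) * β) + 2) /
        (1 / (4 * τ) * β / (B + β)) ≤ 308755200 * (K ^ 5 * τ ^ 4 * M * x ^ 6 * q) := by
    rw [div_eq_mul_one_div]
    calc _ ≤ 15 * (h * M) * (12370 * (q * x ^ 2 * K ^ 2 * τ * h)) *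
          (1664 * (τ * h * K * x ^ 2)) := by gcongr
      _ = 308755200 * (h * h * h) * (M * q * K ^ 3 * τ ^ 2) * (x ^ 2 * x ^ 2) := by ring
      _ ≤ 308755200 * (K ^ 2 * τ ^ 2) * (M * q * K ^ 3 * τ ^ 2) * x ^ 6 := by gcongr
      _ = _ := by ring
  have main2 : 2 * M * ((2 * K * M * q + a / 2) / β + 1) ≤
      162 * (K ^ 5 * τ ^ 4 * M * x ^ 6 * q) := by
    calc 2 * M * ((2 * K * M * q + a / 2) / β + 1)
        ≤ 2 * M * (81 * (K ^ 2 * x ^ 2 * q)) := by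
          refine mul_le_mul_of_nonneg_left (by linarith) (by positivity)
      _ = 162 * (K ^ 2 * 1 * M * x ^ 2 * q) := by ring
      _ ≤ 162 * (K ^ 5 * τ ^ 4 * M * x ^ 6 * q) := by
          have : K ^ 2 ≤ K ^ 5 := pow_le_pow_right₀ hK (by norm_num)
          have : 1 ≤ τ ^ 4 := one_le_pow₀ hτ
          have : x ^ 2 ≤ x ^ 6 := pow_le_pow_right₀ hx1 (by norm_num)
          gcongr
  have hfin : K ^ 5 * M ^ 7 * τ ^ 4 / a ^ 6 = K ^ 5 * τ ^ 4 * M * x ^ 6 := by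
    rw [hx]; field_simp
  rw [hfin]
  have : 0 ≤ K ^ 5 * τ ^ 4 * M * x ^ 6 * q := by positivity
  linarith

theorem theorem1 :
    ∃ C₀ : ℝ, 0 < C₀ ∧
      ∀ (S A : Type*) [Fintype S] [DecidableEq S] [Fintype A] (K N : ℕ), 0 < K → 0 < N →
      ∀ (W : WCMDP S A K N) (rmax cmax : ℝ),
        (∀ i s a, |W.reward i s a| ≤ rmax) →
        (∀ k i s a, W.cost k i s a ≤ cmax) →
      ∀ (y : Fin N → S → A → ℝ) (hy : W.IsLPOptimal y) (τ : ℕ), 0 < τ →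
        (∀ i, IsAperiodicUnichain (W.singleArmMatrix y i)) →
        (∀ i, mixingTime (W.singleArmMatrix y i) (WCMDP.stateDist y i) ≤ (τ : ℕ∞)) →
      (∃ e, W.IsReassignment cmax y e) ∧
      ∀ e : Equiv.Perm (Fin N), W.IsReassignment cmax y e →
      ∀ s₀ : Fin N → S,
        W.IsFeasible (W.idPolicy y hy.1.nonneg e) s₀ ∧
        ∃ R : ℝ,
          Tendsto (fun T => W.avgReward (W.idPolicy y hy.1.nonneg e) s₀ T) atTop (𝓝 R) ∧
          W.optimalValue s₀ - R ≤
            C₀ * ((K : ℝ) ^ 5 * (max rmax cmax) ^ 7 * (τ : ℝ) ^ 4 / W.minBudget ^ 6)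
              / √(N : ℝ) := by
  refine ⟨10 ^ 9, by norm_num, ?_⟩
  intro S A _ _ _ K N hK hN W rmax cmax hr hc y hy τ hτ _ hmix
  refine ⟨WCMDP.exists_isReassignment hy.1 hc hK hN, fun e he s₀ => ?_⟩
  have hfeas := W.idPolicy_isFeasible y hy.1.nonneg e s₀
  refine ⟨hfeas, ?_⟩
  obtain ⟨R, hR⟩ := W.exists_tendsto_avgReward_idPolicy y hy.1.nonneg e s₀
  refine ⟨R, hR, ?_⟩
  have hopt := W.optimalValue_le_lpValue hy hN s₀ ⟨_, hfeas⟩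
  set M := max rmax cmax with hMdef
  have hr' : ∀ i s a, |W.reward i s a| ≤ M := fun i s a => (hr i s a).trans (le_max_left _ _)
  have hc' : ∀ k i s a, W.cost k i s a ≤ M := fun k i s a => (hc k i s a).trans (le_max_right _ _)
  have ha := W.minBudget_pos hK
  have hM0 : 0 ≤ M :=
    (abs_nonneg _).trans (hr' ⟨0, hN⟩ (s₀ ⟨0, hN⟩) W.zeroAction)
  have hK1 : (1 : ℝ) ≤ K := by exact_mod_cast hK
  have hτ1 : (1 : ℝ) ≤ τ := by exact_mod_cast hτ
  have hN1 : (1 : ℝ) ≤ N := by exact_mod_cast hN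
  obtain ⟨h, hh⟩ : ∃ h, h = √((K : ℝ) * τ) := ⟨_, rfl⟩
  have hsq : h * h = K * τ := by rw [hh]; exact Real.mul_self_sqrt (by positivity)
  have hh1 : 1 ≤ h := by
    rw [hh, Real.one_le_sqrt]; nlinarith
  obtain ⟨hγ0, hγ1, -⟩ := mixRate_bounds hτ
  -- The value `12` works because `64 (K + 1) ≤ 128 K ≤ 144 K`.
  obtain ⟨v, hv⟩ := WCMDP.exists_isFeature hy.1 hr' hc' hτ hmix (B := 12 * h * M)
    (by positivity) (by
      have : (12 * h * M) ^ 2 = 144 * (K * τ) * M ^ 2 := by rw [← hsq]; ring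
      rw [this]
      refine mul_le_mul_of_nonneg_right ?_ (sq_nonneg M)
      nlinarith)
  -- In the second case costs exceed the smallest budget, which yields `minBudget ≤ M` and a group
  -- size of at least `K`, both needed for the drift argument.
  rcases le_or_gt cmax W.minBudget with hcase | hcase
  · have h1 := WCMDP.lpValue_le_of_not_binding hv hγ0.le hγ1 hN
      (fun k k' i s a => (hc k i s a).trans (hcase.trans (W.minBudget_le k'))) hR
    have h2 : 0 ≤ 10 ^ 9 * ((K : ℝ) ^ 5 * M ^ 7 * (τ : ℝ) ^ 4 / W.minBudget ^ 6) / √(N : ℝ) := by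
      positivity
    linarith
  · have haM : W.minBudget ≤ M := hcase.le.trans (le_max_right _ _)
    have hM : 0 < M := ha.trans_le haM
    have hcm : W.minBudget / 2 ≤ cmax := by linarith
    have hd0 : 0 < W.groupSize cmax := hK.trans_le (WCMDP.le_groupSize hK hcm)
    have hd0' : (0 : ℝ) < W.groupSize cmax := by exact_mod_cast hd0
    -- Since `groupSize * threshold ≤ M K`, the slack per missing arm is at least `threshold² / (M
    -- K)`, which equals `2 * β`.
    obtain ⟨β, hβ⟩ : ∃ β, β = W.minBudget ^ 2 / (32 * M * K) := ⟨_, rfl⟩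
    have hβ0 : 0 < β := by rw [hβ]; positivity
    have hβd : 2 * β ≤ W.threshold / W.groupSize cmax := by
      have h1 := WCMDP.groupSize_mul_threshold_le (W := W) hK hcm
      have h2 : cmax * K ≤ M * K :=
        mul_le_mul_of_nonneg_right (le_max_right _ _) (by positivity)
      have h3 : W.threshold = W.minBudget / 4 := rfl
      rw [h3] at h1 ⊢
      rw [le_div_iff₀ hd0']
      have h4 : 2 * β * W.groupSize cmax =
          W.groupSize cmax * (W.minBudget / 4) * (W.minBudget / (4 * (M * K))) := by
        rw [hβ]; field_simp; ring
      rw [h4]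
      calc W.groupSize cmax * (W.minBudget / 4) * (W.minBudget / (4 * (M * K)))
          ≤ (M * K) * (W.minBudget / (4 * (M * K))) :=
            mul_le_mul_of_nonneg_right (h1.trans h2) (by positivity)
        _ = W.minBudget / 4 := by field_simp
    have hslack : ∀ k, ∀ n ≤ N, ∑ i with (e i : ℕ) < n, W.meanCost y k i ≤
        W.budget k * N - (2 * β * ((N : ℝ) - n) - W.minBudget / 2) := by
      intro k n hn
      have h1 := WCMDP.sum_meanCost_prefix_le hy.1 hK hN hcm he k hn
      have h2 : W.threshold = W.minBudget / 4 := rfl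
      have h3 : (0 : ℝ) ≤ N - n := by
        rw [sub_nonneg]; exact_mod_cast hn
      have h4 := mul_le_mul_of_nonneg_right hβd h3
      linarith
    have hmain := WCMDP.lpValue_sub_le hv hβ0 hM0 (by positivity) (by positivity) hγ0.le hγ1 hN
      hr' hc' hslack hR
    have hγeq : 1 - mixRate τ = 1 / (4 * (τ : ℝ)) := by unfold mixRate; ring
    rw [hγeq] at hmain
    have hq : 1 ≤ √(N : ℝ) := Real.one_le_sqrt.2 hN1
    have hconst := drift_constant_le hK1 hτ1 hq hh1 hsq ha haM hβ rfl
    have h1 := mul_le_mul_of_nonneg_left hconst (by positivity : 0 ≤ 1 / (N : ℝ))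
    have h2 : (1 / (N : ℝ)) *
        (10 ^ 9 * ((K : ℝ) ^ 5 * M ^ 7 * (τ : ℝ) ^ 4 / W.minBudget ^ 6) * √(N : ℝ)) =
        10 ^ 9 * ((K : ℝ) ^ 5 * M ^ 7 * (τ : ℝ) ^ 4 / W.minBudget ^ 6) / √(N : ℝ) := by
      rw [one_div_mul_eq_div, mul_div_assoc, Real.sqrt_div_self', mul_one_div]
    rw [h2] at h1
    linarith

end
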